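/- **Theorem 4.1 (Main Theorem).** An abelian group is called $\aleph_1$-free if all its countable subgroups are free abelian. Let $R$ be a (unital, associative, not necessarily commutative) ring with $1 \neq 0$ whose additive group is free abelian, and let $\lambda$ be a cardinal with $|R| < \lambda \leq 2^{\aleph_0}$. Then there is an $R$-module $G$ of cardinality $\lambda$ whose additive group is $\aleph_1$-free such that $\operatorname{End} G = R$; that is, the ring homomorphism $R \to \operatorname{End}_{\mathbb{Z}} G$ sending $r$ to scalar multiplication by $r$ is bijective onto the ring of all endomorphisms of the abelian group $G$. Moreover, the following exist (in ZFC): 1. an $\aleph_1$-free abelian group $G$ of cardinality $\aleph_1$ which is rigid, i.e. $n \mapsto (x \mapsto nx)$ is a bijection $\mathbb{Z} \to \operatorname{End} G$, and which is indecomposable, i.e. nonzero and not the direct sum of two nonzero subgroups; 2. an $\aleph_1$-free abelian group of cardinality $\aleph_1$ which is superdecomposable, i.e. every nonzero direct summand of it is a direct sum of two nonzero subgroups; 3. counterexamples to Kaplansky's test problems: $\aleph_1$-free abelian groups $A \not\cong B$ of cardinality $\aleph_1$ such that each is isomorphic to a direct summand of the other; and $\aleph_1$-free abelian groups $A \not\cong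 B$ of cardinality $\aleph_1$ such that $A \oplus A \cong B \oplus B$. -/

import Mathlib

universe u

/-- An abelian group is `ℵ₁`-free if all its countable subgroups are free abelian groups. -/
def AlephOneFree (G : Type*) [AddCommGroup G] : Prop :=
  ∀ H : AddSubgroup G, Countable H → Module.Free ℤ H

/-- The subgroup `A` is a direct summand of `G`: `G` is the internal direct sum of `A` and some
subgroup `B`. -/
def IsDirectSummand {G : Type*} [AddCommGroup G] (A : AddSubgroup G) : Prop :=
  ∃ B : AddSubgroup G, IsCompl A B

/-- `G` is the internal direct sum of two nonzero subgroups. -/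
def IsDecomposable (G : Type*) [AddCommGroup G] : Prop :=
  ∃ A B : AddSubgroup G, A ≠ ⊥ ∧ B ≠ ⊥ ∧ IsCompl A B

/-- A nonzero group which is not the direct sum of two nonzero subgroups. -/
def IsIndecomposable (G : Type*) [AddCommGroup G] : Prop :=
  Nontrivial G ∧ ¬ IsDecomposable G

/-- Every nonzero direct summand of `G` is the direct sum of two nonzero subgroups. -/
def IsSuperdecomposable (G : Type*) [AddCommGroup G] : Prop :=
  ∀ A : AddSubgroup G, IsDirectSummand A → A ≠ ⊥ → IsDecomposable A

/-- `A` is isomorphic to a direct summand of `B`. -/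
def IsIsoToSummand (A B : Type*) [AddCommGroup A] [AddCommGroup B] : Prop :=
  ∃ C : AddSubgroup B, IsDirectSummand C ∧ Nonempty (A ≃+ C)

/-- `End G = R` for an `R`-module `G`: sending `r` to the scalar multiplication `x ↦ r • x` is a
bijection from `R` onto the ring of all additive endomorphisms of `G`
(`Module.toAddMonoidEnd` is this map, as a ring homomorphism). -/
def EndEqScalars (R G : Type*) [Ring R] [AddCommGroup G] [Module R G] : Prop :=
  Function.Bijective (Module.toAddMonoidEnd R G)

/-- A group is rigid if its only endomorphisms are the multiplications by integers, and distinct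
integers give distinct endomorphisms, that is, `End G = ℤ`. -/
def IsRigid (G : Type*) [AddCommGroup G] : Prop :=
  EndEqScalars ℤ G

theorem linearIndependent_of_triangular {S V P ι α : Type*} [Ring S] [AddCommGroup V] [Module S V]
    [AddCommGroup P] [Module S P] [LinearOrder α] (b : ι → V) (δ : ι → V →ₗ[S] P) (ρ : ι → α)
    (hdiag : ∀ i, ∀ c : S, c • δ i (b i) = 0 → c = 0)
    (hoff : ∀ i j, j ≠ i → ρ j ≤ ρ i → δ i (b j) = 0) : LinearIndependent S b := by
  classical
  rw [linearIndependent_iff]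
  intro l hl
  by_contra hne
  obtain ⟨i, hi, hmax⟩ := l.support.exists_max_image ρ (Finsupp.support_nonempty_iff.2 hne)
  have h := congrArg (δ i) hl
  rw [Finsupp.linearCombination_apply, Finsupp.sum, map_sum, map_zero,
    Finset.sum_eq_single i] at h
  · rw [map_smul] at h
    exact (Finsupp.mem_support_iff.1 hi) (hdiag i _ h)
  · intro j hj hji
    rw [map_smul, hoff i j hji (hmax j hj), smul_zero]
  · exact fun h => absurd hi h

theorem Submodule.free_int_of_free {F : Type*} [AddCommGroup F] [Module.Free ℤ F]
    (N : Submodule ℤ F) : Module.Free ℤ N := by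
  classical
  obtain ⟨⟨ι, b⟩⟩ := Module.Free.exists_basis (R := ℤ) (M := F)
  let _ : LinearOrder ι := linearOrderOfSTO WellOrderingRel
  have wf : WellFounded ((· < ·) : ι → ι → Prop) := (WellOrderingRel.isWellOrder (α := ι)).wf
  let low : ι → Submodule ℤ F := fun i =>
    { carrier := {x | x ∈ N ∧ ∀ j, i < j → b.repr x j = 0}
      add_mem' := fun {x y} hx hy => ⟨N.add_mem hx.1 hy.1, fun j hj => by
        simp [hx.2 j hj, hy.2 j hj]⟩
      zero_mem' := ⟨N.zero_mem, fun j _ => by simp⟩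
      smul_mem' := fun c x hx => ⟨N.smul_mem c hx.1, fun j hj => by simp [hx.2 j hj]⟩ }
  let I : ι → Ideal ℤ := fun i => (low i).map (b.coord i)
  have hgen : ∀ i, ∃ x ∈ low i, I i = Ideal.span {b.coord i x} := by
    intro i
    obtain ⟨a, ha⟩ := (IsPrincipalIdealRing.principal (I i)).principal
    have : a ∈ I i := by rw [ha]; exact Submodule.mem_span_singleton_self a
    obtain ⟨x, hx, rfl⟩ := this
    exact ⟨x, hx, ha⟩
  choose x hx hI using hgen
  let κ := {i // b.coord i (x i) ≠ 0}
  let c : κ → N := fun i => ⟨x i.1, (hx i.1).1⟩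
  have hli : LinearIndependent ℤ c := by
    refine linearIndependent_of_triangular c (fun i => (b.coord i.1).comp N.subtype)
      (fun i => i.1) ?_ ?_
    · intro i m hm
      exact (mul_eq_zero.1 hm).resolve_right i.2
    · intro i j hji hle
      exact (hx j.1).2 i.1 (lt_of_le_of_ne hle fun h => hji (Subtype.ext h))
  have htop : ∀ y ∈ N, y ≠ 0 → ∃ k, y ∈ low k ∧ b.repr y k ≠ 0 := by
    intro y hy h0
    have hs : (b.repr y).support.Nonempty := by
      simpa [Finsupp.support_nonempty_iff] using h0
    refine ⟨_, ⟨hy, fun j hj => ?_⟩, Finsupp.mem_support_iff.1 (Finset.max'_mem _ hs)⟩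
    by_contra hne
    exact absurd (Finset.le_max' _ j (Finsupp.mem_support_iff.2 hne)) (not_le.2 hj)
  have hspan : ∀ i, ∀ y (hy : y ∈ low i), (⟨y, hy.1⟩ : N) ∈ Submodule.span ℤ (Set.range c) := by
    intro i
    induction i using wf.induction with
    | _ i ih =>
    have key : ∀ z (hz : z ∈ low i), b.repr z i = 0 →
        (⟨z, hz.1⟩ : N) ∈ Submodule.span ℤ (Set.range c) := by
      intro z hz hzi
      by_cases h0 : z = 0
      · have : (⟨z, hz.1⟩ : N) = 0 := Subtype.ext h0
        rw [this]; exact Submodule.zero_mem _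
      · obtain ⟨k, hk, hk0⟩ := htop z hz.1 h0
        refine ih k ?_ z hk
        rcases lt_trichotomy k i with h | h | h
        · exact h
        · rw [h] at hk0; exact absurd hzi hk0
        · exact absurd (hz.2 k h) hk0
    intro y hy
    have hmem : b.coord i y ∈ I i := ⟨y, hy, rfl⟩
    rw [hI i, Ideal.mem_span_singleton'] at hmem
    obtain ⟨m, hm⟩ := hmem
    have hz : y - m • x i ∈ low i := (low i).sub_mem hy ((low i).smul_mem m (hx i))
    have h1 := key _ hz (by
      have : b.repr y i = m * b.repr (x i) i := hm.symm
      simp [this])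
    have h2 : m • (⟨x i, (hx i).1⟩ : N) ∈ Submodule.span ℤ (Set.range c) := by
      refine Submodule.smul_mem _ _ ?_
      by_cases h0 : b.coord i (x i) = 0
      · exact key _ (hx i) h0
      · exact Submodule.subset_span ⟨⟨i, h0⟩, rfl⟩
    convert Submodule.add_mem _ h1 h2 using 1
    ext; simp
  refine Module.Free.of_basis (Module.Basis.mk hli ?_)
  rintro ⟨y, hy⟩ -
  by_cases h0 : y = 0
  · have : (⟨y, hy⟩ : N) = 0 := Subtype.ext h0
    rw [this]; exact Submodule.zero_mem _
  · obtain ⟨k, hk, -⟩ := htop y hy h0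
    exact hspan k y hk

theorem eq_zero_of_infinite_prime_divisors {M : Type*} [AddCommGroup M] [Module.Free ℤ M] (x : M)
    (P : Set ℕ) (hP : P.Infinite) (h : ∀ p ∈ P, ∃ y : M, p • y = x) : x = 0 := by
  obtain ⟨⟨ι, b⟩⟩ := Module.Free.exists_basis (R := ℤ) (M := M)
  refine b.repr.map_eq_zero_iff.1 (Finsupp.ext fun i => ?_)
  by_contra hne
  refine hP ((b.repr x i).natAbs.divisors.finite_toSet.subset fun p hp => ?_)
  obtain ⟨y, rfl⟩ := h p hp
  simpa [Int.natAbs_mul] using hne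

section Localization

variable {K : Type*} [Ring K] (S : Subring K)

/-- The elements of `K` that lie in `S` after multiplication by an integer prime to `p`. -/
def localizedAt (p : ℕ) : Submodule S K where
  carrier := {a | ∃ m : ℕ, m.Coprime p ∧ m • a ∈ S}
  add_mem' := by
    rintro a b ⟨m, hm, ha⟩ ⟨n, hn, hb⟩
    refine ⟨m * n, hm.mul_left hn, ?_⟩
    rw [smul_add]
    refine S.add_mem ?_ ?_
    · rw [mul_comm, mul_smul]; exact S.nsmul_mem ha n
    · rw [mul_smul]; exact S.nsmul_mem hb m
  zero_mem' := ⟨1, Nat.coprime_one_left p, by simp⟩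
  smul_mem' := by
    rintro c a ⟨m, hm, ha⟩
    refine ⟨m, hm, ?_⟩
    rw [smul_comm]
    exact S.mul_mem c.2 ha

theorem mem_localizedAt_of_mem {p : ℕ} {a : K} (ha : a ∈ S) : a ∈ localizedAt S p :=
  ⟨1, Nat.coprime_one_left p, by simpa⟩

theorem inv_smul_mem_localizedAt [Algebra ℚ K] {p m : ℕ} (hm : m.Coprime p) (h0 : m ≠ 0) {a : K}
    (ha : a ∈ localizedAt S p) : (m : ℚ)⁻¹ • a ∈ localizedAt S p := by
  obtain ⟨n, hn, ha⟩ := ha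
  refine ⟨n * m, hn.mul_left hm, ?_⟩
  rwa [mul_smul, ← Nat.cast_smul_eq_nsmul ℚ m, smul_inv_smul₀ (Nat.cast_ne_zero.2 h0)]

theorem mem_of_forall_mem_localizedAt {a : K} (ha : ∀ p : ℕ, p.Prime → a ∈ localizedAt S p) :
    a ∈ S := by
  classical
  have hex : ∃ n : ℕ, n ≠ 0 ∧ n • a ∈ S := by
    obtain ⟨m, hm, h⟩ := ha 2 Nat.prime_two
    exact ⟨m, by rintro rfl; simp at hm, h⟩
  obtain ⟨h0, hN⟩ := Nat.find_spec hex
  set N := Nat.find hex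
  by_cases h1 : N = 1
  · simpa [h1] using hN
  obtain ⟨p, hp, k, hk⟩ := Nat.exists_prime_and_dvd h1
  obtain ⟨m, hm, h⟩ := ha p hp
  have hg : (N.gcd m) • a ∈ S := by
    have : ((N.gcd m : ℕ) : ℤ) • a = (N.gcdA m) • (N • a) + (N.gcdB m) • (m • a) := by
      rw [Nat.gcd_eq_gcd_ab, add_smul, mul_comm, mul_smul, natCast_zsmul, mul_comm (m : ℤ),
        mul_smul, natCast_zsmul]
    rw [natCast_zsmul] at this
    rw [this]
    exact S.add_mem (S.zsmul_mem hN _) (S.zsmul_mem h _)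
  have hle : N ≤ N.gcd m := Nat.find_min' hex ⟨Nat.gcd_ne_zero_left h0, hg⟩
  have hNm : N ∣ m := by
    have := Nat.le_antisymm hle (Nat.gcd_le_left m (Nat.pos_of_ne_zero h0))
    rw [this]; exact Nat.gcd_dvd_right _ _
  exact absurd (hm.symm.eq_one_of_dvd ((Dvd.intro _ hk.symm).trans hNm)) hp.ne_one

theorem eq_zero_of_infinite_localizedAt [Algebra ℚ K] [Module.Free ℤ S] {a : K}
    (ha : ∃ n : ℕ, n ≠ 0 ∧ n • a ∈ S) (P : Set ℕ) (hP : P.Infinite)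
    (h : ∀ p ∈ P, ∃ b ∈ localizedAt S p, a = p • b) : a = 0 := by
  obtain ⟨n, hn, hS⟩ := ha
  have hz : (⟨n • a, hS⟩ : S) = 0 := by
    refine eq_zero_of_infinite_prime_divisors _ P hP fun p hp => ?_
    obtain ⟨b, ⟨m, hm, hb⟩, hab⟩ := h p hp
    have e1 : (m : ℤ) • (⟨n • a, hS⟩ : S) = (p : ℤ) • (n • (⟨m • b, hb⟩ : S)) := by
      ext
      simp only [natCast_zsmul]
      push_cast
      simp only [hab]
      simp only [nsmul_eq_mul, ← mul_assoc, ← Nat.cast_mul]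
      congr 2
      ring
    have e2 : (1 : ℤ) = m * Nat.gcdA m p + p * Nat.gcdB m p := by
      rw [← Nat.gcd_eq_gcd_ab, hm]; rfl
    refine ⟨Nat.gcdA m p • (n • (⟨m • b, hb⟩ : S)) + Nat.gcdB m p • ⟨n • a, hS⟩, ?_⟩
    rw [← natCast_zsmul, smul_add, smul_comm, ← e1]
    conv_rhs => rw [← one_smul ℤ (⟨n • a, hS⟩ : S), e2]
    rw [add_smul, smul_smul, smul_smul, mul_comm (m : ℤ)]
  have : n • a = 0 := congrArg Subtype.val hz
  rw [← Nat.cast_smul_eq_nsmul ℚ] at this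
  exact (smul_eq_zero.1 this).resolve_left (Nat.cast_ne_zero.2 hn)

end Localization

section Branches

/-- The node of level `n` on the branch `x` of the binary tree. -/
def branchNode (x : ℕ → Bool) (n : ℕ) : List Bool := (List.range n).map x

@[simp] theorem branchNode_length (x : ℕ → Bool) (n : ℕ) : (branchNode x n).length = n := by
  simp [branchNode]

theorem branchNode_eq_iff {x y : ℕ → Bool} {n : ℕ} :
    branchNode x n = branchNode y n ↔ ∀ i < n, x i = y i := by
  simp [branchNode]

theorem branchNode_eq_iff_length {x y : ℕ → Bool} {m n : ℕ} :
    branchNode x m = branchNode y n ↔ m = n ∧ ∀ i < n, x i = y i := by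
  constructor
  · intro h
    have := congrArg List.length h
    simp only [branchNode_length] at this
    subst this
    exact ⟨rfl, branchNode_eq_iff.1 h⟩
  · rintro ⟨rfl, h⟩
    exact branchNode_eq_iff.2 h

theorem branchNode_injective (x : ℕ → Bool) : Function.Injective (branchNode x) := fun _ _ h =>
  (branchNode_eq_iff_length.1 h).1

/-- A bijection of the nodes of the binary tree with the primes. -/
noncomputable def nodePrimeEquiv : List Bool ≃ Nat.Primes :=
  Classical.choice (nonempty_equiv_of_countable)

/-- The prime attached to a node of the binary tree. -/
noncomputable def nodePrime (t : List Bool) : ℕ := (nodePrimeEquiv t).1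

theorem nodePrime_prime (t : List Bool) : (nodePrime t).Prime := (nodePrimeEquiv t).2

theorem nodePrime_injective : Function.Injective nodePrime := fun _ _ h =>
  nodePrimeEquiv.injective (Subtype.ext h)

theorem exists_nodePrime_eq {p : ℕ} (hp : p.Prime) : ∃ t, nodePrime t = p :=
  ⟨_, congrArg Subtype.val (nodePrimeEquiv.apply_symm_apply ⟨p, hp⟩)⟩

/-- The product of the primes at the first `m` nodes of the branch `x`. -/
noncomputable def branchProd (x : ℕ → Bool) (m : ℕ) : ℕ :=
  ∏ i ∈ Finset.range m, nodePrime (branchNode x i)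

theorem branchProd_ne_zero (x : ℕ → Bool) (m : ℕ) : branchProd x m ≠ 0 :=
  Finset.prod_ne_zero_iff.2 fun _ _ => (nodePrime_prime _).ne_zero

theorem branchProd_succ (x : ℕ → Bool) (m : ℕ) :
    branchProd x (m + 1) = branchProd x m * nodePrime (branchNode x m) :=
  Finset.prod_range_succ _ _

theorem nodePrime_coprime {s t : List Bool} (h : s ≠ t) : (nodePrime s).Coprime (nodePrime t) :=
  (Nat.coprime_primes (nodePrime_prime s) (nodePrime_prime t)).2 fun e => h (nodePrime_injective e)

theorem branchProd_coprime {x : ℕ → Bool} {m : ℕ} {t : List Bool}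
    (h : ∀ i < m, branchNode x i ≠ t) : (branchProd x m).Coprime (nodePrime t) :=
  Nat.Coprime.prod_left fun i hi => nodePrime_coprime (h i (Finset.mem_range.1 hi))

theorem exists_branchProd_eq_mul (x : ℕ → Bool) {k m : ℕ} (hkm : k < m) :
    ∃ q, branchProd x m = branchProd x (k + 1) * q ∧ q ≠ 0 ∧
      q.Coprime (nodePrime (branchNode x k)) := by
  refine ⟨∏ i ∈ Finset.Ico (k + 1) m, nodePrime (branchNode x i),
    (Finset.prod_range_mul_prod_Ico _ hkm).symm,
    Finset.prod_ne_zero_iff.2 fun _ _ => (nodePrime_prime _).ne_zero,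
    Nat.Coprime.prod_left fun i hi => nodePrime_coprime fun h => ?_⟩
  have := branchNode_injective x h
  have := (Finset.mem_Ico.1 hi).1
  omega

end Branches

section BranchModule

open Finsupp

variable {K : Type*} [Ring K] (S : Subring K) {A : Type*}
  (ν : A → ℕ → Bool) (g : A → (List Bool →₀ K))

/-- The finitely supported functions all of whose values lie in a given submodule. -/
def valuesIn {S : Subring K} (N : Submodule S K) : Submodule S (List Bool →₀ K) where
  carrier := {w | ∀ s, w s ∈ N}
  add_mem' := fun ha hb s => N.add_mem (ha s) (hb s)
  zero_mem' := fun _ => N.zero_mem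
  smul_mem' := fun c _ h s => N.smul_mem c (h s)

/-- The contribution of the `i`-th node of the branch `x` twisted by the vector `w`. -/
noncomputable def branchTerm (x : ℕ → Bool) (w : List Bool →₀ K) (i : ℕ) : List Bool →₀ K :=
  single (branchNode x i) 1 + if x i then w else 0

theorem branchTerm_mem {S : Subring K} (x : ℕ → Bool) {w : List Bool →₀ K} (hw : ∀ s, w s ∈ S) (i : ℕ)
    (s : List Bool) : branchTerm x w i s ∈ S := by
  rw [branchTerm, Finsupp.add_apply]
  refine S.add_mem ?_ ?_
  · rw [single_apply]; split_ifs
    exacts [S.one_mem, S.zero_mem]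
  · split_ifs
    exacts [hw s, S.zero_mem]

variable [Algebra ℚ K]

/-- The weighted sum of the first `m` contributions of the branch `x`. -/
noncomputable def branchSum (x : ℕ → Bool) (w : List Bool →₀ K) (m : ℕ) : List Bool →₀ K :=
  ∑ i ∈ Finset.range m, (branchProd x i : ℚ) • branchTerm x w i

theorem branchSum_succ (x : ℕ → Bool) (w : List Bool →₀ K) (m : ℕ) :
    branchSum x w (m + 1) = branchSum x w m + (branchProd x m : ℚ) • branchTerm x w m :=
  Finset.sum_range_succ _ _

/-- The basis vector attached to a node of the tree. -/
noncomputable def nodeVec (K : Type*) [Ring K] (A : Type*) (t : List Bool) :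
    (List Bool →₀ K) × (A →₀ K) :=
  (single t 1, 0)

/-- The `m`-th quotient of the vector attached to the branch of index `β`. -/
noncomputable def branchVec (β : A) (m : ℕ) : (List Bool →₀ K) × (A →₀ K) :=
  (branchProd (ν β) m : ℚ)⁻¹ • (-branchSum (ν β) (g β) m, single β 1)

theorem branchProd_smul_branchVec (β : A) (m : ℕ) :
    (branchProd (ν β) m : ℚ) • branchVec ν g β m = (-branchSum (ν β) (g β) m, single β 1) := by
  rw [branchVec, smul_inv_smul₀ (Nat.cast_ne_zero.2 (branchProd_ne_zero _ _))]

theorem nodePrime_smul_branchVec_succ (β : A) (m : ℕ) :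
    (nodePrime (branchNode (ν β) m) : ℚ) • branchVec ν g β (m + 1) =
      branchVec ν g β m - (branchTerm (ν β) (g β) m, 0) := by
  have h0 : (branchProd (ν β) m : ℚ) ≠ 0 := Nat.cast_ne_zero.2 (branchProd_ne_zero _ _)
  rw [← smul_right_inj h0, smul_smul, ← Nat.cast_mul, ← branchProd_succ,
    branchProd_smul_branchVec, smul_sub, branchProd_smul_branchVec, branchSum_succ]
  ext1
  · simp [sub_eq_add_neg, add_comm]
  · simp

/-- The generators of `branchModule`. -/
noncomputable def branchGen : List Bool ⊕ A × ℕ → (List Bool →₀ K) × (A →₀ K) :=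
  Sum.elim (nodeVec K A) fun i => branchVec ν g i.1 i.2

/-- The module generated by the node vectors and the quotients of the branch vectors. -/
noncomputable def branchModule : Submodule S ((List Bool →₀ K) × (A →₀ K)) :=
  Submodule.span S (Set.range (branchGen ν g))

theorem nodeVec_mem (t : List Bool) : nodeVec K A t ∈ branchModule S ν g :=
  Submodule.subset_span ⟨Sum.inl t, rfl⟩

theorem branchVec_mem (β : A) (m : ℕ) : branchVec ν g β m ∈ branchModule S ν g :=
  Submodule.subset_span ⟨Sum.inr (β, m), rfl⟩

/-- The first component after the change of basis that replaces each branch vector through the node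
`t` by its first quotient divided by the prime of `t`. -/
noncomputable def nodeProj (t : List Bool) :
    (List Bool →₀ K) × (A →₀ K) →ₗ[K] (List Bool →₀ K) :=
  LinearMap.fst K _ _ + (linearCombination K fun β =>
    if branchNode (ν β) t.length = t then branchSum (ν β) (g β) (t.length + 1) else 0) ∘ₗ
      LinearMap.snd K _ _

theorem nodeProj_apply (t : List Bool) (v : (List Bool →₀ K) × (A →₀ K)) :
    nodeProj ν g t v = v.1 + v.2.sum fun β c => c •
      if branchNode (ν β) t.length = t then branchSum (ν β) (g β) (t.length + 1) else 0 := by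
  simp [nodeProj, linearCombination_apply]

theorem nodeProj_branchVec (t : List Bool) (β : A) (m : ℕ) :
    nodeProj ν g t (branchVec ν g β m) = (branchProd (ν β) m : ℚ)⁻¹ •
      ((if branchNode (ν β) t.length = t then branchSum (ν β) (g β) (t.length + 1) else 0) -
        branchSum (ν β) (g β) m) := by
  rw [branchVec, LinearMap.map_smul_of_tower, nodeProj_apply, Finsupp.sum_single_index (by simp), one_smul,
    neg_add_eq_sub]

variable {ν g} {S}

theorem exists_branchSum_eq_add (x : ℕ → Bool) {w : List Bool →₀ K} (hw : ∀ s, w s ∈ S)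
    {k m : ℕ} (hkm : k ≤ m) : ∃ r : List Bool →₀ K, (∀ s, r s ∈ S) ∧
      branchSum x w m = branchSum x w k + (branchProd x k : ℚ) • r := by
  induction m, hkm using Nat.le_induction with
  | base => exact ⟨0, fun _ => S.zero_mem, by simp⟩
  | succ m hkm ih =>
    obtain ⟨r, hr, h⟩ := ih
    refine ⟨r + (∏ i ∈ Finset.Ico k m, nodePrime (branchNode x i)) • branchTerm x w m,
      fun s => S.add_mem (hr s) (S.nsmul_mem (branchTerm_mem x hw m s) _), ?_⟩
    have : branchProd x m = branchProd x k * ∏ i ∈ Finset.Ico k m, nodePrime (branchNode x i) :=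
      (Finset.prod_range_mul_prod_Ico _ hkm).symm
    rw [branchSum_succ, h, smul_add, add_assoc, this, Nat.cast_mul, mul_smul,
      Nat.cast_smul_eq_nsmul ℚ (∏ i ∈ _, _)]

theorem branchSum_mem (x : ℕ → Bool) {w : List Bool →₀ K} (hw : ∀ s, w s ∈ S) (m : ℕ)
    (s : List Bool) : branchSum x w m s ∈ S := by
  obtain ⟨r, hr, h⟩ := exists_branchSum_eq_add x hw (Nat.zero_le m)
  rw [h]
  simpa [branchSum, branchProd] using hr s

theorem nodeProj_apply_mem (hg : ∀ β s, g β s ∈ S) {v : (List Bool →₀ K) × (A →₀ K)}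
    (hv : v ∈ branchModule S ν g) (t s : List Bool) :
    nodeProj ν g t v s ∈ localizedAt S (nodePrime t) := by
  have hle : branchModule S ν g ≤ (valuesIn (localizedAt S (nodePrime t))).comap
      ((nodeProj ν g t).restrictScalars S) := by
    rw [branchModule, Submodule.span_le]
    rintro _ ⟨t' | ⟨β, m⟩, rfl⟩ s
    · apply mem_localizedAt_of_mem
      simp only [branchGen, Sum.elim_inl, nodeVec, LinearMap.coe_restrictScalars, nodeProj_apply,
        sum_zero_index, add_zero, single_apply]
      split_ifs
      exacts [S.one_mem, S.zero_mem]
    · simp only [branchGen, Sum.elim_inr, LinearMap.coe_restrictScalars, nodeProj_branchVec]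
      split_ifs with ht
      · rcases le_or_gt m t.length with hm | hm
        · obtain ⟨r, hr, h⟩ := exists_branchSum_eq_add (ν β) (hg β) (hm.trans (Nat.le_succ _))
          rw [h, add_sub_cancel_left, inv_smul_smul₀ (Nat.cast_ne_zero.2 (branchProd_ne_zero _ _))]
          exact mem_localizedAt_of_mem S (hr s)
        · obtain ⟨r, hr, h⟩ := exists_branchSum_eq_add (ν β) (hg β) hm
          obtain ⟨q, hq, hq0, hqc⟩ := exists_branchProd_eq_mul (ν β) hm
          rw [h, sub_add_cancel_left, hq, Nat.cast_mul, mul_inv_rev, mul_smul, smul_neg,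
            inv_smul_smul₀ (Nat.cast_ne_zero.2 (branchProd_ne_zero _ _))]
          rw [ht] at hqc
          exact inv_smul_mem_localizedAt S hqc hq0
            (mem_localizedAt_of_mem S (S.neg_mem (hr s)))
      · rw [zero_sub]
        refine inv_smul_mem_localizedAt S (branchProd_coprime fun i _ hi => ht ?_)
          (branchProd_ne_zero _ _)
          (mem_localizedAt_of_mem S (S.neg_mem (branchSum_mem _ (hg β) _ s)))
        rw [← hi, branchNode_length]
  exact hle hv s

theorem snd_apply_mem {v : (List Bool →₀ K) × (A →₀ K)}
    (hv : v ∈ branchModule S ν g) {t : List Bool} {γ : A} (ht : branchNode (ν γ) t.length ≠ t) :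
    v.2 γ ∈ localizedAt S (nodePrime t) := by
  have hle : branchModule S ν g ≤ (localizedAt S (nodePrime t)).comap
      ((lapply γ ∘ₗ LinearMap.snd K _ _).restrictScalars S) := by
    rw [branchModule, Submodule.span_le]
    rintro _ ⟨t' | ⟨β, m⟩, rfl⟩
    · simp [branchGen, nodeVec]
    · change ((branchProd (ν β) m : ℚ)⁻¹ • single β (1 : K)) γ ∈ localizedAt S (nodePrime t)
      rw [Finsupp.smul_apply]
      by_cases h : β = γ
      · subst h
        refine inv_smul_mem_localizedAt S (branchProd_coprime fun i _ hi => ht ?_)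
          (branchProd_ne_zero _ _) (mem_localizedAt_of_mem S (by simp))
        rw [← hi, branchNode_length]
      · rw [single_eq_of_ne' h, smul_zero]
        exact Submodule.zero_mem _
  exact hle hv

end BranchModule

section Endomorphisms

open Finsupp

variable {K : Type*} [Ring K] [Algebra ℚ K] {S : Subring K} {A : Type*}
  {ν : A → ℕ → Bool} {g : A → (List Bool →₀ K)}

theorem mem_nodePrime_smul_of_branchProd_smul {x : ℕ → Bool} {n : ℕ} {a : K}
    (h : ∃ b ∈ localizedAt S (nodePrime (branchNode x n)),
      (branchProd x n : ℚ) • a = nodePrime (branchNode x n) • b) :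
    ∃ b ∈ localizedAt S (nodePrime (branchNode x n)), a = nodePrime (branchNode x n) • b := by
  obtain ⟨b, hb, h⟩ := h
  refine ⟨(branchProd x n : ℚ)⁻¹ • b, inv_smul_mem_localizedAt S
    (branchProd_coprime fun i hi h => hi.ne (branchNode_injective x h)) (branchProd_ne_zero _ _) hb,
    ?_⟩
  rw [← smul_comm, ← h, inv_smul_smul₀ (Nat.cast_ne_zero.2 (branchProd_ne_zero _ _))]

theorem eq_zero_of_frequently_nodePrime_smul [Module.Free ℤ S] {a : K}
    (ha : ∃ n : ℕ, n ≠ 0 ∧ n • a ∈ S)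
    (h : ∀ L : ℕ, ∃ t : List Bool, L ≤ t.length ∧
      ∃ b ∈ localizedAt S (nodePrime t), a = nodePrime t • b) : a = 0 := by
  let Q : Set (List Bool) := {t | ∃ b ∈ localizedAt S (nodePrime t), a = nodePrime t • b}
  have hQ : Q.Infinite := by
    intro hfin
    obtain ⟨L, hL⟩ := (hfin.image List.length).bddAbove
    obtain ⟨t, ht, hQ⟩ := h (L + 1)
    have := hL ⟨t, hQ, rfl⟩
    omega
  refine eq_zero_of_infinite_localizedAt S ha (nodePrime '' Q)
    (hQ.image nodePrime_injective.injOn) ?_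
  rintro _ ⟨t, ht, rfl⟩
  exact ht

theorem exists_level_forall_branchNode_ne (hν : Function.Injective ν) (β : A) (E : Set A)
    (hE : E.Finite) : ∃ l, ∀ n, l ≤ n → ∀ γ ∈ E, γ ≠ β → branchNode (ν γ) n ≠ branchNode (ν β) n := by
  have : ∀ᶠ n in Filter.atTop, ∀ γ ∈ E, γ ≠ β → branchNode (ν γ) n ≠ branchNode (ν β) n := by
    rw [Filter.eventually_all_finite hE]
    intro γ _
    by_cases h : γ = β
    · simp [h]
    · obtain ⟨i, hi⟩ := Function.ne_iff.1 (fun e => h (hν e))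
      filter_upwards [Filter.eventually_gt_atTop i] with n hn _ he
      exact hi (branchNode_eq_iff.1 he i hn)
  exact Filter.eventually_atTop.1 this

theorem branchVec_zero (β : A) : branchVec ν g β 0 = (0, single β 1) := by
  simp [branchVec, branchSum, branchProd]

theorem branchVec_zero_eq_add (β : A) (m : ℕ) :
    branchVec ν g β 0 = branchProd (ν β) m • branchVec ν g β m + (branchSum (ν β) (g β) m, 0) := by
  rw [← Nat.cast_smul_eq_nsmul ℚ, branchProd_smul_branchVec, branchVec_zero]
  simp

theorem branchProd_congr {x y : ℕ → Bool} {n : ℕ} (h : ∀ i < n, x i = y i) :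
    branchProd x (n + 1) = branchProd y (n + 1) := by
  refine Finset.prod_congr rfl fun i hi => ?_
  rw [branchNode_eq_iff.2 fun j hj => h j (by have := Finset.mem_range.1 hi; omega)]

theorem branchSum_congr {x y : ℕ → Bool} {n : ℕ} (w : List Bool →₀ K) (h : ∀ i < n, x i = y i) :
    branchSum x w n = branchSum y w n := by
  refine Finset.sum_congr rfl fun i hi => ?_
  have hi := Finset.mem_range.1 hi
  have hn : branchNode x i = branchNode y i := branchNode_eq_iff.2 fun j hj => h j (hj.trans hi)
  have hp : branchProd x i = branchProd y i :=
    Finset.prod_congr rfl fun j hj => by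
      rw [branchNode_eq_iff.2 fun k hk => h k (by have := Finset.mem_range.1 hj; omega)]
  rw [branchTerm, branchTerm, hn, hp, h i hi]

theorem branchSum_succ_sub {x y : ℕ → Bool} {n : ℕ} (w : List Bool →₀ K) (h : ∀ i < n, x i = y i)
    (hx : x n = true) (hy : y n = false) :
    branchSum x w (n + 1) - branchSum y w (n + 1) = branchProd x n • w := by
  have hn : branchNode x n = branchNode y n := branchNode_eq_iff.2 h
  have hp : branchProd x n = branchProd y n := by
    refine mul_right_cancel₀ (nodePrime_prime (branchNode x n)).ne_zero ?_
    rw [← branchProd_succ, branchProd_congr h, branchProd_succ, hn]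
  rw [branchSum_succ, branchSum_succ, branchSum_congr w h, branchTerm, branchTerm, hx, hy, ← hp,
    ← hn]
  simp [Nat.cast_smul_eq_nsmul ℚ]

theorem nodeProj_eq_fst {t : List Bool} {v : (List Bool →₀ K) × (A →₀ K)}
    (h : ∀ γ, branchNode (ν γ) t.length = t → v.2 γ = 0) : nodeProj ν g t v = v.1 := by
  rw [nodeProj_apply, Finsupp.sum, Finset.sum_eq_zero, add_zero]
  intro γ _
  split_ifs with ht
  · rw [h γ ht, zero_smul]
  · rw [smul_zero]

theorem nodeProj_branchVec_zero {t : List Bool} {β : A} (h : branchNode (ν β) t.length = t) :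
    nodeProj ν g t (branchVec ν g β 0) = branchSum (ν β) (g β) (t.length + 1) := by
  rw [nodeProj_branchVec, if_pos h]
  simp [branchSum, branchProd]

theorem fst_apply_mem_of_snd_eq_zero (hg : ∀ β s, g β s ∈ S)
    {v : (List Bool →₀ K) × (A →₀ K)} (hv : v ∈ branchModule S ν g) (h : v.2 = 0)
    (s : List Bool) : v.1 s ∈ S := by
  refine mem_of_forall_mem_localizedAt S fun p hp => ?_
  obtain ⟨t, rfl⟩ := exists_nodePrime_eq hp
  have := nodeProj_apply_mem hg hv t s
  rwa [nodeProj_eq_fst fun γ _ => by simp [h]] at this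

theorem eq_zero_of_forall_branchProd_smul [Module.Free ℤ S] (hfrac : ∀ a : K, ∃ n : ℕ, n ≠ 0 ∧ n • a ∈ S)
    (hν : Function.Injective ν) (hg : ∀ β s, g β s ∈ S)
    {v : (List Bool →₀ K) × (A →₀ K)} (β : A)
    (h : ∀ m, ∃ v' ∈ branchModule S ν g, v = branchProd (ν β) m • v') : v = 0 := by
  have h' : ∀ n, ∃ v' ∈ branchModule S ν g, v = nodePrime (branchNode (ν β) n) • v' := by
    intro n
    obtain ⟨v', hv', hv⟩ := h (n + 1)
    refine ⟨branchProd (ν β) n • v', Submodule.smul_of_tower_mem _ _ hv', ?_⟩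
    rw [hv, branchProd_succ, mul_comm, mul_smul]
  have h2 : ∀ γ, γ ≠ β → v.2 γ = 0 := by
    intro γ hγ
    obtain ⟨l, hl⟩ := exists_level_forall_branchNode_ne hν β {γ} (Set.finite_singleton γ)
    refine eq_zero_of_frequently_nodePrime_smul (hfrac _) fun L =>
      ⟨branchNode (ν β) (max l L), by simp, ?_⟩
    obtain ⟨v', hv', rfl⟩ := h' (max l L)
    exact ⟨_, snd_apply_mem hv' (by simpa using hl _ (le_max_left l L) γ rfl hγ), rfl⟩
  have hproj : ∀ n s, ∃ b ∈ localizedAt S (nodePrime (branchNode (ν β) n)),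
      v.1 s + v.2 β * branchSum (ν β) (g β) (n + 1) s = nodePrime (branchNode (ν β) n) • b := by
    intro n s
    obtain ⟨v', hv', hv⟩ := h' n
    refine ⟨_, nodeProj_apply_mem hg hv' (branchNode (ν β) n) s, ?_⟩
    rw [← Finsupp.smul_apply, ← map_nsmul, ← hv, nodeProj_apply, Finsupp.sum_eq_single β]
    · simp
    · intro γ _ hγ
      rw [h2 γ hγ, zero_smul]
    · simp
  have h3 : v.2 β = 0 := by
    refine eq_zero_of_frequently_nodePrime_smul (hfrac _) fun L => ?_
    have hfin := (((v.1.support ∪ (g β).support).finite_toSet).image List.length).bddAbove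
    obtain ⟨M, hM⟩ := hfin
    set n := max L (M + 1) with hn
    refine ⟨branchNode (ν β) n, by simp [hn], mem_nodePrime_smul_of_branchProd_smul ?_⟩
    have hout : branchNode (ν β) n ∉ v.1.support ∪ (g β).support := by
      intro hmem
      have := hM ⟨_, hmem, rfl⟩
      simp at this
      omega
    simp only [Finset.mem_union, Finsupp.mem_support_iff, not_or, not_not] at hout
    obtain ⟨b, hb, hv⟩ := hproj n (branchNode (ν β) n)
    refine ⟨b, hb, ?_⟩
    rw [← hv, hout.1, zero_add, branchSum, Finsupp.finsetSum_apply, Finset.sum_range_succ,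
      Finset.sum_eq_zero, zero_add]
    · simp only [branchTerm, Finsupp.smul_apply, Finsupp.add_apply, single_eq_same]
      split_ifs <;> simp [hout.2]
    · intro i hi
      have : branchNode (ν β) i ≠ branchNode (ν β) n := fun e =>
        (Finset.mem_range.1 hi).ne (branchNode_injective _ e)
      simp only [branchTerm, Finsupp.smul_apply, Finsupp.add_apply, single_eq_of_ne' this]
      split_ifs <;> simp [hout.2]
  have h4 : ∀ s, v.1 s = 0 := by
    intro s
    refine eq_zero_of_frequently_nodePrime_smul (hfrac _) fun L =>
      ⟨branchNode (ν β) L, by simp, ?_⟩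
    simpa [h3] using hproj L s
  refine Prod.ext (Finsupp.ext h4) (Finsupp.ext fun γ => ?_)
  by_cases h : γ = β
  · rw [h]; exact h3
  · exact h2 γ h

end Endomorphisms

section Endomorphisms

open Finsupp Cardinal

variable {K : Type u} [Ring K] {S : Subring K} {A : Type u}
  {ν : A → ℕ → Bool} {g : A → (List Bool →₀ K)}

/-- Two branches of the family that agree up to level `L`, carry the same vector `w`, and whose
images have the same traces on a given finite amount of data. -/
theorem exists_branches_agreeing (hν : Function.Injective ν) [Infinite K] {w : List Bool →₀ K}
    (hcard : #K < #{β // g β = w}) (z : A → (List Bool →₀ K) × (A →₀ K)) (E : Finset A) :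
    ∃ c : K, ∀ L : ℕ, ∃ β β' : A, ∃ n : ℕ, L ≤ n ∧ g β = w ∧ g β' = w ∧
      (∀ i < n, ν β i = ν β' i) ∧ ν β n = true ∧ ν β' n = false ∧
      (z β).1 = (z β').1 ∧ (∀ γ ∈ E, (z β).2 γ = (z β').2 γ) ∧
      (∀ γ ∈ E, branchNode (ν γ) n ≠ branchNode (ν β) n) ∧
      (z β).2 β = c ∧ (z β').2 β' = c ∧
      (∀ γ, γ ≠ β → branchNode (ν γ) n = branchNode (ν β) n → (z β).2 γ = 0) ∧
      (∀ γ, γ ≠ β' → branchNode (ν γ) n = branchNode (ν β) n → (z β').2 γ = 0) := by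
  classical
  have hl : ∀ β, ∃ l, ∀ n, l ≤ n → ∀ γ ∈ (((z β).2.support ∪ E : Finset A) : Set A), γ ≠ β →
      branchNode (ν γ) n ≠ branchNode (ν β) n := fun β =>
    exists_level_forall_branchNode_ne hν β _ (Finset.finite_toSet _)
  choose l hl using hl
  let D := K × (List Bool →₀ K) × (E → K) × ULift.{u} (List Bool)
  let f : {β // g β = w} → D := fun β =>
    ((z β).2 β, (z β).1, fun γ => (z β).2 γ, ⟨branchNode (ν β) (l β)⟩)
  have hK : ℵ₀ ≤ #K := aleph0_le_mk K
  have hD : #D ≤ #K := by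
    have h1 : #(List Bool →₀ K) ≤ #K := by
      rw [mk_finsupp_lift_of_infinite]
      simp [hK]
    have h2 : #(E → K) ≤ #K := by
      rw [mk_arrow]
      simpa using power_nat_le (n := E.card) hK
    have h3 : #(ULift.{u} (List Bool)) ≤ #K := (mk_le_aleph0 (α := ULift.{u} (List Bool))).trans hK
    simp only [D, mk_prod, lift_id]
    exact mul_le_of_le hK le_rfl (mul_le_of_le hK h1 (mul_le_of_le hK h2 h3))
  have : Infinite {β // g β = w} := by
    rw [infinite_iff]; exact hK.trans hcard.le
  obtain ⟨d, hd⟩ := exists_infinite_fiber f (hD.trans_lt hcard)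
  refine ⟨d.1, fun L => ?_⟩
  have hF : Set.Infinite {β : A | g β = w ∧ (z β).2 β = d.1 ∧ (z β).1 = d.2.1 ∧
      (∀ γ : E, (z β).2 γ = d.2.2.1 γ) ∧ branchNode (ν β) (l β) = d.2.2.2.down} := by
    have := (Set.infinite_coe_iff.1 hd).image Subtype.val_injective.injOn
    refine this.mono ?_
    rintro _ ⟨β, hβ, rfl⟩
    have hβ : f β = d := hβ
    rw [← hβ]
    exact ⟨β.2, rfl, rfl, fun _ => rfl, rfl⟩
  have hFE := hF.sdiff E.finite_toSet
  have := hFE.to_subtype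
  obtain ⟨⟨β, hβ⟩, ⟨β', hβ'⟩, hne, heq⟩ := Finite.exists_ne_map_eq_of_infinite
    (fun β : ↑({β : A | g β = w ∧ (z β).2 β = d.1 ∧ (z β).1 = d.2.1 ∧
      (∀ γ : E, (z β).2 γ = d.2.2.1 γ) ∧ branchNode (ν β) (l β) = d.2.2.2.down} \ (E : Set A)) =>
      fun i : Fin L => ν β i)
  have hne' : ν β ≠ ν β' := fun h => hne (Subtype.ext (hν h))
  have hagree : ∀ i < L, ν β i = ν β' i := fun i hi => congrFun heq ⟨i, hi⟩
  have hex := Function.ne_iff.1 hne'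
  set n := Nat.find hex with hn
  have hspec : ν β n ≠ ν β' n := Nat.find_spec hex
  have hmin : ∀ i < n, ν β i = ν β' i := fun i hi => not_not.1 (Nat.find_min hex hi)
  have hLn : L ≤ n := by
    by_contra h
    exact hspec (hagree n (not_le.1 h))
  obtain ⟨⟨h1, h2, h3, h4, h5⟩, h6⟩ := hβ
  obtain ⟨⟨h1', h2', h3', h4', h5'⟩, h6'⟩ := hβ'
  have hll := branchNode_eq_iff_length.1 (h5.trans h5'.symm)
  have hln' : l β' ≤ n := by
    by_contra h
    exact hspec (hll.2 n (not_le.1 h))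
  have hln : l β ≤ n := hll.1.le.trans hln'
  have hnode : branchNode (ν β) n = branchNode (ν β') n := branchNode_eq_iff.2 hmin
  have hE : ∀ γ ∈ E, branchNode (ν γ) n ≠ branchNode (ν β) n := fun γ hγ =>
    hl β n hln γ (by simp [hγ]) (fun h => h6 (h ▸ hγ))
  have hz : ∀ γ, γ ≠ β → branchNode (ν γ) n = branchNode (ν β) n → (z β).2 γ = 0 := by
    intro γ hγ he
    by_contra h0
    exact hl β n hln γ (by simp [h0]) hγ he
  have hz' : ∀ γ, γ ≠ β' → branchNode (ν γ) n = branchNode (ν β) n → (z β').2 γ = 0 := by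
    intro γ hγ he
    by_contra h0
    exact hl β' n hln' γ (by simp [h0]) hγ (he.trans hnode)
  cases hb : ν β n
  · refine ⟨β', β, n, hLn, h1', h1, fun i hi => (hmin i hi).symm, ?_, hb, h3'.trans h3.symm,
      fun γ hγ => (h4' ⟨γ, hγ⟩).trans (h4 ⟨γ, hγ⟩).symm, fun γ hγ => hnode ▸ hE γ hγ, h2', h2,
      fun γ hγ he => hz' γ hγ (he.trans hnode.symm), fun γ hγ he => hz γ hγ (he.trans hnode.symm)⟩
    cases hb' : ν β' n
    · exact absurd (hb.trans hb'.symm) hspec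
    · rfl
  · refine ⟨β, β', n, hLn, h1, h1', hmin, hb, ?_, h3.trans h3'.symm,
      fun γ hγ => (h4 ⟨γ, hγ⟩).trans (h4' ⟨γ, hγ⟩).symm, hE, h2, h2', hz, hz'⟩
    cases hb' : ν β' n
    · rfl
    · exact absurd (hb.trans hb'.symm) hspec

variable [Algebra ℚ K]

theorem exists_map_eq_smul [Module.Free ℤ S] (hfrac : ∀ a : K, ∃ n : ℕ, n ≠ 0 ∧ n • a ∈ S)
    (hν : Function.Injective ν) (hg : ∀ β s, g β s ∈ S) [Infinite K] {w : List Bool →₀ K}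
    (hcard : #K < #{β // g β = w}) (hw : ((w, 0) : (List Bool →₀ K) × (A →₀ K)) ∈ branchModule S ν g)
    (φ : branchModule S ν g →+ branchModule S ν g) (r : S) :
    ∃ c : K, (φ (r • ⟨(w, 0), hw⟩) : (List Bool →₀ K) × (A →₀ K)) = (c • w, 0) := by
  classical
  let y : A → ℕ → branchModule S ν g := fun β m => ⟨branchVec ν g β m, branchVec_mem S ν g β m⟩
  let x : (List Bool →₀ K) × (A →₀ K) := φ (r • ⟨(w, 0), hw⟩)
  obtain ⟨c, hc⟩ := exists_branches_agreeing hν hcard (fun β => φ (r • y β 0)) x.2.support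
  have main : ∀ L, ∃ t : List Bool, L ≤ t.length ∧
      (∀ γ, ∃ b ∈ localizedAt S (nodePrime t), x.2 γ = nodePrime t • b) ∧
      ∀ s, ∃ b ∈ localizedAt S (nodePrime t), (c • w - x.1) s = nodePrime t • b := by
    intro L
    obtain ⟨β, β', n, hLn, hβ, hβ', hagree, hb, hb', hz1, hzE, hE, hcβ, hcβ', hz, hz'⟩ := hc L
    have hne : β ≠ β' := by rintro rfl; rw [hb] at hb'; cases hb'
    have hnode : branchNode (ν β) n = branchNode (ν β') n := branchNode_eq_iff.2 hagree
    have hprod := branchProd_congr hagree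
    have hdiff : branchVec ν g β 0 - branchVec ν g β' 0 - branchProd (ν β) n • (w, 0) =
        branchProd (ν β) (n + 1) • (branchVec ν g β (n + 1) - branchVec ν g β' (n + 1)) := by
      have := branchSum_succ_sub w hagree hb hb'
      rw [sub_eq_iff_eq_add] at this
      rw [branchVec_zero_eq_add β (n + 1), branchVec_zero_eq_add β' (n + 1), ← hprod, hβ, hβ', this,
        smul_sub]
      ext1
      · simp only [Prod.fst_add, Prod.fst_sub, Prod.smul_fst]
        abel
      · simp
    have hφ : ∀ a b, φ (a - b) = φ a - φ b := map_sub φ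
    have hdiff' : r • y β 0 - r • y β' 0 - branchProd (ν β) n • r • ⟨(w, 0), hw⟩ =
        nodePrime (branchNode (ν β) n) •
          branchProd (ν β) n • r • (y β (n + 1) - y β' (n + 1)) := by
      have hr : ∀ a b : branchModule S ν g, r • a - r • b = r • (a - b) := fun a b =>
        (smul_sub r a b).symm
      rw [smul_comm _ r, smul_comm _ r, smul_comm _ r, hr, hr, smul_smul, mul_comm,
        ← branchProd_succ]
      exact congrArg (r • ·) (Subtype.ext hdiff)
    have himg := congrArg (fun v => (φ v : (List Bool →₀ K) × (A →₀ K))) hdiff'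
    simp only [hφ, map_nsmul] at himg
    set v' : branchModule S ν g :=
      branchProd (ν β) n • φ (r • (y β (n + 1) - y β' (n + 1))) with hv'
    set z : (List Bool →₀ K) × (A →₀ K) := (φ (r • y β 0)).val with hzdef
    set z' : (List Bool →₀ K) × (A →₀ K) := (φ (r • y β' 0)).val with hzdef'
    have heq : z - z' - branchProd (ν β) n • x = nodePrime (branchNode (ν β) n) • v'.1 := himg
    have hx0 : ∀ γ, branchNode (ν γ) n = branchNode (ν β) n → x.2 γ = 0 := fun γ hγ => by
      by_contra h
      exact hE γ (by simpa using h) hγ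
    refine ⟨branchNode (ν β) n, by simpa, fun γ => ?_, fun s => ?_⟩
    · by_cases hγ : γ ∈ x.2.support
      · refine mem_nodePrime_smul_of_branchProd_smul ⟨-v'.1.2 γ, Submodule.neg_mem _
          (snd_apply_mem v'.2 (by simpa using hE γ hγ)), ?_⟩
        have := congrArg (fun v => v.2 γ) heq
        simp only [Prod.snd_sub, Prod.smul_snd, Finsupp.sub_apply, Finsupp.smul_apply, hzE γ hγ,
          sub_self, zero_sub] at this
        rw [smul_neg, ← this, neg_neg, Nat.cast_smul_eq_nsmul]
      · exact ⟨0, Submodule.zero_mem _, by simpa using hγ⟩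
    · refine mem_nodePrime_smul_of_branchProd_smul ⟨_, nodeProj_apply_mem hg v'.2 _ s, ?_⟩
      have hsum : nodeProj ν g (branchNode (ν β) n) (z - z' - branchProd (ν β) n • x) =
          branchProd (ν β) n • (c • w - x.1) := by
        have h1 : nodeProj ν g (branchNode (ν β) n)
            (z - z' - branchProd (ν β) n • x - c • (branchVec ν g β 0 - branchVec ν g β' 0)) =
            - (branchProd (ν β) n • x.1) := by
          rw [nodeProj_eq_fst]
          · simp [branchVec_zero, hz1]
          · intro γ hγ
            rw [branchNode_length] at hγ
            simp only [branchVec_zero, Prod.snd_sub, Prod.smul_snd, Finsupp.sub_apply,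
              Finsupp.smul_apply, hx0 γ hγ, smul_zero, sub_zero]
            by_cases h : γ = β
            · subst h
              rw [hcβ, hz' γ hne hγ, single_eq_same, single_eq_of_ne' hne.symm]
              simp
            · by_cases h' : γ = β'
              · subst h'
                rw [hcβ', hz γ h hγ, single_eq_same, single_eq_of_ne' (Ne.symm h)]
                simp
              · rw [hz γ h hγ, hz' γ h' hγ, single_eq_of_ne' (Ne.symm h),
                  single_eq_of_ne' (Ne.symm h')]
                simp
        rw [map_sub, map_smul, map_sub _ (branchVec ν g β 0), nodeProj_branchVec_zero (by simp),
          nodeProj_branchVec_zero (by simp [hnode]), hβ, hβ', branchNode_length,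
          branchSum_succ_sub w hagree hb hb', sub_eq_iff_eq_add] at h1
        rw [h1, smul_sub, smul_comm c]
        abel
      rw [heq, map_nsmul] at hsum
      rw [Nat.cast_smul_eq_nsmul, ← Finsupp.smul_apply, ← hsum, Finsupp.smul_apply]
  refine ⟨c, Prod.ext (Finsupp.ext fun s => ?_) (Finsupp.ext fun γ => ?_)⟩
  · refine (sub_eq_zero.1 (eq_zero_of_frequently_nodePrime_smul (S := S)
      (a := (c • w) s - x.1 s) (hfrac _) fun L => ?_)).symm
    obtain ⟨t, ht, -, h⟩ := main L
    exact ⟨t, ht, by simpa using h s⟩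
  · refine eq_zero_of_frequently_nodePrime_smul (S := S) (hfrac _) fun L => ?_
    obtain ⟨t, ht, h, -⟩ := main L
    exact ⟨t, ht, h γ⟩

/-- An additive endomorphism is a scalar multiplication as soon as every vector `x_t + r x_s` is
carried by sufficiently many branches. -/
theorem exists_forall_map_eq_smul [Module.Free ℤ S] (hfrac : ∀ a : K, ∃ n : ℕ, n ≠ 0 ∧ n • a ∈ S)
    (hν : Function.Injective ν) (hg : ∀ β s, g β s ∈ S) [Infinite K]
    (hcard : ∀ t s : List Bool, ∀ r : S, #K < #{β // g β = single t 1 + single s (r : K)})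
    (φ : branchModule S ν g →+ branchModule S ν g) : ∃ a : S, ∀ v, φ v = a • v := by
  let e : List Bool → branchModule S ν g := fun t => ⟨nodeVec K A t, nodeVec_mem S ν g t⟩
  have key : ∀ t s, t ≠ s → ∀ r r' : S, ∃ c : S,
      φ (r' • (e t + r • e s)) = c • (e t + r • e s) := by
    intro t s hts r r'
    have hval : ((e t + r • e s : branchModule S ν g) : (List Bool →₀ K) × (A →₀ K)) =
        (single t 1 + single s (r : K), 0) := by
      ext1
      · simp [e, nodeVec, Subring.smul_def]
      · simp [e, nodeVec]
    have hw := hval ▸ (e t + r • e s).2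
    obtain ⟨c, hc⟩ := exists_map_eq_smul hfrac hν hg (hcard t s r) hw φ r'
    have hcS : c ∈ S := by
      have := fst_apply_mem_of_snd_eq_zero hg (φ (r' • ⟨_, hw⟩)).2 (by rw [hc]) t
      rw [hc] at this
      simpa [single_eq_of_ne hts] using this
    refine ⟨⟨c, hcS⟩, Subtype.ext ?_⟩
    have he : e t + r • e s = ⟨_, hw⟩ := Subtype.ext hval
    rw [he, hc]
    ext1
    · rfl
    · simp [Subring.smul_def]
  have hindep : ∀ t s, t ≠ s → ∀ a b c d : S, a • e t + b • e s = c • e t + d • e s →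
      a = c ∧ b = d := by
    intro t s hts a b c d h
    have h1 := congrArg (fun v : branchModule S ν g => v.1.1 t) h
    have h2 := congrArg (fun v : branchModule S ν g => v.1.1 s) h
    simp only [e, nodeVec, Submodule.coe_add, Submodule.coe_smul_of_tower, Prod.fst_add,
      Prod.smul_fst, Finsupp.add_apply, Finsupp.smul_apply, single_eq_same, single_eq_of_ne hts,
      single_eq_of_ne' hts, Subring.smul_def, smul_eq_mul, mul_one, mul_zero, add_zero,
      zero_add] at h1 h2
    exact ⟨Subtype.ext h1, Subtype.ext h2⟩
  have hone : ∀ t, ∀ r' : S, ∃ c : S, φ (r' • e t) = c • e t := by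
    intro t r'
    obtain ⟨c, hc⟩ := key t (true :: t) (List.cons_ne_self _ _).symm 0 r'
    exact ⟨c, by simpa using hc⟩
  choose f hf using hone
  have hff : ∀ t s, t ≠ s → ∀ r r', f s (r' * r) = f t r' * r := by
    intro t s hts r r'
    obtain ⟨c, hc⟩ := key t s hts r r'
    rw [smul_add, map_add, hf, smul_smul, hf, smul_add, smul_smul] at hc
    obtain ⟨h1, h2⟩ := hindep t s hts _ _ _ _ hc
    rw [h1, h2]
  have hfa : ∀ t r, f t r = f [] 1 * r := by
    intro t r
    by_cases ht : t = []
    · subst ht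
      have h1 := hff [true] [] (by simp) r 1
      have h2 := hff [] [true] (by simp) 1 1
      rwa [one_mul, ← one_mul (1 : S), h2, mul_one] at h1
    · simpa using hff [] t (Ne.symm ht) r 1
  set a := f [] 1
  refine ⟨a, ?_⟩
  let ψ : branchModule S ν g →+ branchModule S ν g := φ - DistribSMul.toAddMonoidHom _ a
  have hψ : ∀ v, ψ v = φ v - a • v := fun _ => rfl
  have hψe : ∀ r : S, ∀ t, ψ (r • e t) = 0 := fun r t => by
    rw [hψ, hf, hfa, mul_smul]
    exact sub_self (a • r • e t)
  have hψ0 : ∀ r : S, ∀ v : branchModule S ν g, v.1.2 = 0 → ψ (r • v) = 0 := by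
    intro r v hv
    have hS := fst_apply_mem_of_snd_eq_zero hg v.2 hv
    have : v = ∑ t ∈ v.1.1.support, (⟨v.1.1 t, hS t⟩ : S) • e t := by
      refine Subtype.ext (Prod.ext ?_ ?_)
      · rw [Submodule.coe_sum, Prod.fst_sum]
        conv_lhs => rw [← Finsupp.sum_single v.1.1]
        refine Finset.sum_congr rfl fun t _ => ?_
        simp [e, nodeVec, Subring.smul_def]
      · rw [Submodule.coe_sum, Prod.snd_sum, hv, Finset.sum_eq_zero]
        intro t _
        simp [e, nodeVec]
    rw [this, Finset.smul_sum, map_sum, Finset.sum_eq_zero]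
    intro t _
    rw [smul_smul, hψe]
  let y : A → ℕ → branchModule S ν g := fun β m => ⟨branchVec ν g β m, branchVec_mem S ν g β m⟩
  have hy : ∀ r : S, ∀ β m, ψ (r • y β 0) = branchProd (ν β) m • ψ (r • y β m) := by
    intro r β m
    have h := hψ0 r (y β 0 - branchProd (ν β) m • y β m) (by
      change (branchVec ν g β 0 - branchProd (ν β) m • branchVec ν g β m).2 = 0
      rw [branchVec_zero_eq_add β m]
      simp)
    have hs : r • (y β 0 - branchProd (ν β) m • y β m) =
        r • y β 0 - r • branchProd (ν β) m • y β m := smul_sub r (y β 0) (branchProd (ν β) m • y β m)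
    have hs' : ψ (r • y β 0 - r • branchProd (ν β) m • y β m) =
        ψ (r • y β 0) - ψ (r • branchProd (ν β) m • y β m) := map_sub ψ (r • y β 0) (r • branchProd (ν β) m • y β m)
    rw [hs, hs', smul_comm r, map_nsmul] at h
    exact sub_eq_zero.1 h
  have hy0 : ∀ r : S, ∀ β m, ψ (r • y β m) = 0 := by
    intro r β m
    have h0 : ψ (r • y β 0) = 0 := Subtype.ext
      (eq_zero_of_forall_branchProd_smul hfrac hν hg β fun m =>
        ⟨ψ (r • y β m), (ψ (r • y β m)).2, congrArg Subtype.val (hy r β m)⟩)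
    have h1 := congrArg Subtype.val ((hy r β m).symm.trans h0)
    rw [Submodule.coe_smul_of_tower, ← Nat.cast_smul_eq_nsmul ℚ] at h1
    exact Subtype.ext ((smul_eq_zero.1 h1).resolve_left
      (Nat.cast_ne_zero.2 (branchProd_ne_zero _ _)))
  have hall : ∀ v (hv : v ∈ branchModule S ν g), ∀ r : S, ψ (r • ⟨v, hv⟩) = 0 := by
    intro v hv
    induction hv using Submodule.span_induction with
    | mem x hx =>
      obtain ⟨t | ⟨β, m⟩, rfl⟩ := hx
      exacts [fun r => hψe r t, fun r => hy0 r β m]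
    | zero => exact fun r => (congrArg ψ (smul_zero r)).trans (map_zero ψ)
    | add x y hx hy h1 h2 =>
      intro r
      have : r • (⟨x + y, Submodule.add_mem _ hx hy⟩ : branchModule S ν g) =
        r • ⟨x, hx⟩ + r • ⟨y, hy⟩ := smul_add r (⟨x, hx⟩ : branchModule S ν g) ⟨y, hy⟩
      exact (congrArg ψ this).trans (by rw [map_add, h1, h2, add_zero])
    | smul c x hx h =>
      intro r
      exact (congrArg ψ (smul_smul r c (⟨x, hx⟩ : branchModule S ν g))).trans (h (r * c))
  intro v
  have := hall v v.2 1
  rw [one_smul, hψ] at this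
  exact sub_eq_zero.1 this

end Endomorphisms

section AlephOneFree

open Finsupp

variable {K : Type*} [Ring K] {S : Subring K} {A : Type u}
  {ν : A → ℕ → Bool} {g : A → (List Bool →₀ K)}

theorem mk_zero_mem_of_forall_nodeVec_mem (M : Submodule S ((List Bool →₀ K) × (A →₀ K)))
    {w : List Bool →₀ K} (hw : ∀ s, w s ∈ S) (h : ∀ s ∈ w.support, nodeVec K A s ∈ M) :
    ((w, 0) : (List Bool →₀ K) × (A →₀ K)) ∈ M := by
  have : ((w, 0) : (List Bool →₀ K) × (A →₀ K)) =
      ∑ s ∈ w.support, (⟨w s, hw s⟩ : S) • nodeVec K A s := by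
    refine Prod.ext ?_ ?_
    · rw [Prod.fst_sum]
      conv_lhs => rw [← Finsupp.sum_single w]
      refine Finset.sum_congr rfl fun t _ => ?_
      simp [nodeVec, Subring.smul_def]
    · rw [Prod.snd_sum, Finset.sum_eq_zero]
      intro t _
      simp [nodeVec]
  rw [this]
  exact M.sum_mem fun s hs => M.smul_mem _ (h s hs)

variable [Algebra ℚ K]

theorem branchSum_apply_eq_zero {x : ℕ → Bool} {w : List Bool →₀ K} {m : ℕ} {s : List Bool}
    (hw : w s = 0) (h : ∀ i < m, branchNode x i ≠ s) : branchSum x w m s = 0 := by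
  rw [branchSum, Finsupp.finsetSum_apply, Finset.sum_eq_zero]
  intro i hi
  simp only [branchTerm, Finsupp.smul_apply, Finsupp.add_apply,
    single_eq_of_ne' (h i (Finset.mem_range.1 hi))]
  split_ifs <;> simp [hw]

theorem branchSum_apply_branchNode {x : ℕ → Bool} {w : List Bool →₀ K} {m n : ℕ}
    (hw : w (branchNode x n) = 0) (hnm : n < m) :
    branchSum x w m (branchNode x n) = (branchProd x n : ℚ) • (1 : K) := by
  rw [branchSum, Finsupp.finsetSum_apply, Finset.sum_eq_single n]
  · simp only [branchTerm, Finsupp.smul_apply, Finsupp.add_apply, single_eq_same]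
    split_ifs <;> simp [hw]
  · intro i _ hi
    simp only [branchTerm, Finsupp.smul_apply, Finsupp.add_apply,
      single_eq_of_ne' (fun e => hi (branchNode_injective x e))]
    split_ifs <;> simp [hw]
  · exact fun h => absurd (Finset.mem_range.2 hnm) h

theorem exists_linearIndependent_span (hν : Function.Injective ν) (hg : ∀ β s, g β s ∈ S)
    (E : Set A) (hE : E.Countable) :
    ∃ (ι : Type u) (b : ι → (List Bool →₀ K) × (A →₀ K)), LinearIndependent S b ∧
      (∀ t, nodeVec K A t ∈ Submodule.span S (Set.range b)) ∧
      ∀ β ∈ E, ∀ m, branchVec ν g β m ∈ Submodule.span S (Set.range b) := by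
  classical
  obtain ⟨e, he⟩ := Set.countable_iff_exists_injOn.1 hE
  have hN : ∀ β, ∃ N, ∀ m, N ≤ m → ∀ γ ∈ {γ ∈ E | e γ ≤ e β},
      (∀ s, m ≤ s.length → g γ s = 0) ∧ (γ ≠ β → branchNode (ν γ) m ≠ branchNode (ν β) m) := by
    intro β
    have hfin : {γ ∈ E | e γ ≤ e β}.Finite := by
      refine Set.Finite.of_finite_image ((Set.finite_Iic (e β)).subset ?_)
        (he.mono fun γ h => h.1)
      rintro _ ⟨γ, h, rfl⟩
      exact h.2
    obtain ⟨l, hl⟩ := exists_level_forall_branchNode_ne hν β _ hfin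
    have : ∀ᶠ m in Filter.atTop, ∀ γ ∈ {γ ∈ E | e γ ≤ e β}, ∀ s, m ≤ s.length → g γ s = 0 := by
      rw [Filter.eventually_all_finite hfin]
      intro γ _
      obtain ⟨M, hM⟩ := ((g γ).support.finite_toSet.image List.length).bddAbove
      filter_upwards [Filter.eventually_gt_atTop M] with m hm s hs
      by_contra h
      have := hM ⟨s, Finsupp.mem_support_iff.2 h, rfl⟩
      omega
    obtain ⟨N, hN⟩ := Filter.eventually_atTop.1 this
    exact ⟨max l N, fun m hm γ hγ => ⟨hN m (le_of_max_le_right hm) γ hγ,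
      hl m (le_of_max_le_left hm) γ hγ⟩⟩
  choose N hN using hN
  let tail : Set (List Bool) := {t | ∃ β ∈ E, ∃ m, N β ≤ m ∧ branchNode (ν β) m = t}
  let I := {t // t ∉ tail} ⊕ {p : A × ℕ // p.1 ∈ E ∧ N p.1 ≤ p.2}
  let b : I → (List Bool →₀ K) × (A →₀ K) :=
    Sum.elim (fun t => nodeVec K A t.1) fun p => branchVec ν g p.1.1 p.1.2
  have hT : ∀ β ∈ E, ∀ m, N β ≤ m → ∀ γ ∈ E, e γ ≤ e β → ∀ n,
      (branchVec ν g γ n).1 (branchNode (ν β) m) =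
        if γ = β ∧ m < n then -(((branchProd (ν γ) n : ℚ)⁻¹ * branchProd (ν γ) m) • (1 : K))
        else 0 := by
    intro β hβ m hm γ hγ hle n
    have h0 : g γ (branchNode (ν β) m) = 0 := (hN β m hm γ ⟨hγ, hle⟩).1 _ (by simp)
    simp only [branchVec, Prod.smul_fst, Finsupp.smul_apply, Finsupp.neg_apply]
    split_ifs with h
    · obtain ⟨rfl, h⟩ := h
      rw [branchSum_apply_branchNode h0 h, smul_neg, smul_smul]
    · rw [branchSum_apply_eq_zero h0, neg_zero, smul_zero]
      intro i hi heq
      have him := (branchNode_eq_iff_length.1 heq).1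
      subst him
      by_cases hγβ : γ = β
      · exact h ⟨hγβ, hi⟩
      · exact (hN β i hm γ ⟨hγ, hle⟩).2 hγβ heq
  let T : List Bool → (List Bool →₀ K) × (A →₀ K) →ₗ[S] K := fun t =>
    (lapply t ∘ₗ LinearMap.fst K _ _).restrictScalars S
  let U : A → (List Bool →₀ K) × (A →₀ K) →ₗ[S] K := fun β =>
    (lapply β ∘ₗ LinearMap.snd K _ _).restrictScalars S
  have hTa : ∀ t v, T t v = v.1 t := fun _ _ => rfl
  have hUa : ∀ β v, U β v = v.2 β := fun _ _ => rfl
  let δ : I → (List Bool →₀ K) × (A →₀ K) →ₗ[S] K := Sum.elim (fun t => T t.1) fun p =>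
    if p.1.2 = N p.1.1 then branchProd (ν p.1.1) p.1.2 • U p.1.1 + T (branchNode (ν p.1.1) p.1.2)
    else T (branchNode (ν p.1.1) p.1.2) - nodePrime (branchNode (ν p.1.1) (p.1.2 - 1)) •
      T (branchNode (ν p.1.1) (p.1.2 - 1))
  have hδ : ∀ β (hβ : β ∈ E) m (hm : N β ≤ m) n, N β ≤ n →
      δ (Sum.inr ⟨(β, m), hβ, hm⟩) (branchVec ν g β n) = if m = n then 1 else 0 := by
    intro β hβ m hm n hn
    have hu : (branchVec ν g β n).2 β = (branchProd (ν β) n : ℚ)⁻¹ • 1 := by simp [branchVec]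
    have hone : (branchProd (ν β) n : ℚ)⁻¹ * branchProd (ν β) n = 1 :=
      inv_mul_cancel₀ (Nat.cast_ne_zero.2 (branchProd_ne_zero _ _))
    have ht : ∀ k, N β ≤ k → (branchVec ν g β n).1 (branchNode (ν β) k) =
        if k < n then -(((branchProd (ν β) n : ℚ)⁻¹ * branchProd (ν β) k) • (1 : K)) else 0 := by
      intro k hk
      simpa using hT β hβ k hk β hβ le_rfl n
    simp only [δ, Sum.elim_inr]
    split_ifs with h1 h2 h2
    · subst h2
      simp only [LinearMap.add_apply, LinearMap.smul_apply, hTa, hUa, hu, ht m hm,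
        lt_irrefl, if_false, add_zero]
      rw [← Nat.cast_smul_eq_nsmul ℚ, smul_smul, mul_comm, hone, one_smul]
    · have hlt : m < n := by omega
      simp only [LinearMap.add_apply, LinearMap.smul_apply, hTa, hUa, hu, ht m hm, if_pos hlt]
      rw [← Nat.cast_smul_eq_nsmul ℚ, smul_smul, mul_comm, add_neg_cancel]
    all_goals
      obtain ⟨k, rfl⟩ : ∃ k, m = k + 1 := ⟨m - 1, by omega⟩
      simp only [LinearMap.sub_apply, LinearMap.smul_apply, hTa, ht _ hm, Nat.add_sub_cancel,
        ht k (by omega)]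
    · subst h2
      rw [if_neg (lt_irrefl _), if_pos (Nat.lt_succ_self k), smul_neg, sub_neg_eq_add, zero_add,
        ← Nat.cast_smul_eq_nsmul ℚ, smul_smul, mul_comm, mul_assoc, ← Nat.cast_mul,
        ← branchProd_succ, hone, one_smul]
    · by_cases hlt : k + 1 < n
      · rw [if_pos hlt, if_pos (by omega), smul_neg, ← Nat.cast_smul_eq_nsmul ℚ, smul_smul,
          mul_comm (nodePrime _ : ℚ), mul_assoc, ← Nat.cast_mul, ← branchProd_succ, sub_self]
      · rw [if_neg hlt, if_neg (by omega), smul_zero, sub_zero]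
  have hli : LinearIndependent S b := by
    refine linearIndependent_of_triangular b δ (Sum.elim (fun _ => 0) fun p => e p.1.1 + 1) ?_ ?_
    · rintro (⟨t, ht⟩ | ⟨⟨β, m⟩, hβ, hm⟩) c hc
      · simpa [δ, b, hTa, nodeVec, Subring.smul_def] using hc
      · have h := (hδ β hβ m hm m hm).trans (if_pos rfl)
        change c • δ (Sum.inr ⟨(β, m), hβ, hm⟩) (branchVec ν g β m) = 0 at hc
        rw [h] at hc
        simpa [Subring.smul_def] using hc
    · rintro (⟨t, ht⟩ | ⟨⟨β, m⟩, hβ, hm⟩) (⟨s, hs⟩ | ⟨⟨γ, n⟩, hγ, hn⟩) hne hle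
      · have : s ≠ t := fun h => hne (by subst h; rfl)
        simp [δ, b, hTa, nodeVec, single_eq_of_ne' this]
      · simp at hle
      · change N β ≤ m at hm
        have hs' : ∀ k, N β ≤ k → s ≠ branchNode (ν β) k := fun k hk h =>
          hs ⟨β, hβ, k, hk, h.symm⟩
        simp only [δ, b, Sum.elim_inr, Sum.elim_inl]
        split_ifs with h
        · simp [hTa, hUa, nodeVec, single_eq_of_ne' (hs' m hm)]
        · simp [hTa, nodeVec, single_eq_of_ne' (hs' m hm),
            single_eq_of_ne' (hs' (m - 1) (by omega))]
      · change N β ≤ m at hm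
        by_cases hγβ : γ = β
        · subst hγβ
          have hmn : m ≠ n := fun h => hne (by subst h; rfl)
          exact (hδ γ hβ m hm n hn).trans (if_neg hmn)
        · have hle : e γ ≤ e β := by simpa using hle
          have hu : (branchVec ν g γ n).2 β = 0 := by
            simp [branchVec, single_eq_of_ne' hγβ]
          simp only [δ, b, Sum.elim_inr]
          split_ifs with h
          · simp [hTa, hUa, hu, hT β hβ m hm γ hγ hle, hγβ]
          · simp [hTa, hT β hβ m hm γ hγ hle, hT β hβ (m - 1) (by omega) γ hγ hle, hγβ]
  have hterm : ∀ β m, ((branchTerm (ν β) (g β) m, 0) : (List Bool →₀ K) × (A →₀ K)) =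
      branchVec ν g β m - nodePrime (branchNode (ν β) m) • branchVec ν g β (m + 1) := by
    intro β m
    rw [← Nat.cast_smul_eq_nsmul ℚ, nodePrime_smul_branchVec_succ, sub_sub_cancel]
  set M := Submodule.span S (Set.range b) with hM
  have hbase : ∀ β ∈ E, ∀ m, N β ≤ m → branchVec ν g β m ∈ M := fun β hβ m hm =>
    Submodule.subset_span ⟨Sum.inr ⟨(β, m), hβ, hm⟩, rfl⟩
  have hnode : ∀ n t, t.length = n → nodeVec K A t ∈ M := by
    intro n
    induction n using Nat.strong_induction_on with
    | _ n ih =>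
    intro t ht
    by_cases h : t ∈ tail
    · obtain ⟨β, hβ, m, hm, rfl⟩ := h
      have hmn : m = n := by simpa using ht
      subst hmn
      have hgM : ((g β, 0) : (List Bool →₀ K) × (A →₀ K)) ∈ M :=
        mk_zero_mem_of_forall_nodeVec_mem M (hg β) fun s hs => ih s.length (by
          by_contra hlt
          exact Finsupp.mem_support_iff.1 hs
            ((hN β m hm β ⟨hβ, le_rfl⟩).1 s (not_lt.1 hlt))) s rfl
      have h1 : ((branchTerm (ν β) (g β) m, 0) : (List Bool →₀ K) × (A →₀ K)) ∈ M := by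
        rw [hterm]
        exact M.sub_mem (hbase β hβ m hm)
          (Submodule.smul_of_tower_mem _ _ (hbase β hβ _ (hm.trans (Nat.le_succ _))))
      have h2 : nodeVec K A (branchNode (ν β) m) = (branchTerm (ν β) (g β) m, 0) -
          if ν β m then (g β, 0) else 0 := by
        rw [branchTerm, nodeVec]
        split_ifs <;> simp
      rw [h2]
      refine M.sub_mem h1 ?_
      split_ifs
      exacts [hgM, M.zero_mem]
    · exact Submodule.subset_span ⟨Sum.inl ⟨t, h⟩, rfl⟩
  refine ⟨I, b, hli, fun t => hnode _ t rfl, fun β hβ m => ?_⟩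
  rcases le_total (N β) m with hm | hm
  · exact hbase β hβ m hm
  · induction hm using Nat.decreasingInduction with
    | self => exact hbase β hβ _ le_rfl
    | of_succ k hk ih =>
      have : branchVec ν g β k = nodePrime (branchNode (ν β) k) • branchVec ν g β (k + 1) +
          (branchTerm (ν β) (g β) k, 0) := by
        rw [hterm]; abel
      rw [this]
      exact M.add_mem (Submodule.smul_of_tower_mem _ _ ih)
        (mk_zero_mem_of_forall_nodeVec_mem M (branchTerm_mem _ (hg β) k) fun s _ => hnode _ s rfl)

theorem alephOneFree_branchModule [Module.Free ℤ S] (hν : Function.Injective ν)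
    (hg : ∀ β s, g β s ∈ S) : AlephOneFree (branchModule S ν g) := by
  intro H hH
  have hex : ∀ h : H, ∃ l : (List Bool ⊕ A × ℕ) →₀ S,
      (l.sum fun i a => a • branchGen ν g i) = h.1.1 := fun h =>
    Finsupp.mem_span_range_iff_exists_finsupp.1 h.1.2
  choose l hl using hex
  let E : Set A := ⋃ h : H, {β | ∃ m, Sum.inr (β, m) ∈ (l h).support}
  have hE : E.Countable := by
    refine Set.countable_iUnion fun h => ?_
    refine (((l h).support.finite_toSet.image fun i => Sum.elim (fun _ => none)
      (fun p => some p.1) i).preimage (Option.some_injective A).injOn).countable.mono ?_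
    rintro β ⟨m, hm⟩
    exact ⟨_, hm, rfl⟩
  obtain ⟨ι, b, hb, hnode, hbranch⟩ := exists_linearIndependent_span (K := K) hν hg E hE
  have hfreeS : Module.Free S (Submodule.span S (Set.range b)) :=
    Module.Free.of_basis (Module.Basis.span hb)
  have hfree : Module.Free ℤ (Submodule.span S (Set.range b)) := Module.Free.trans (S := S)
  have hmem : ∀ h : H, h.1.1 ∈ Submodule.span S (Set.range b) := by
    intro h
    rw [← hl h]
    refine Submodule.sum_mem _ fun i hi => Submodule.smul_mem _ _ ?_
    rcases i with t | ⟨β, m⟩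
    · exact hnode t
    · exact hbranch β (Set.mem_iUnion.2 ⟨h, m, hi⟩) m
  let f : H →+ Submodule.span S (Set.range b) :=
    { toFun := fun h => ⟨h.1.1, hmem h⟩
      map_zero' := rfl
      map_add' := fun _ _ => rfl }
  have hf : Function.Injective f.toIntLinearMap := fun x y h =>
    Subtype.ext (Subtype.ext (congrArg (fun v => v.1) h))
  have := Submodule.free_int_of_free (LinearMap.range f.toIntLinearMap)
  exact Module.Free.of_equiv (LinearEquiv.ofInjective f.toIntLinearMap hf).symm

end AlephOneFree

section Realization

open Finsupp Cardinal TensorProduct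

theorem exists_nsmul_mem_range_includeRight (R : Type u) [Ring R] (a : ℚ ⊗[ℤ] R) :
    ∃ n : ℕ, n ≠ 0 ∧ n • a ∈
      (Algebra.TensorProduct.includeRight : R →ₐ[ℤ] ℚ ⊗[ℤ] R).toRingHom.range := by
  induction a using TensorProduct.induction_on with
  | zero => exact ⟨1, one_ne_zero, by simp⟩
  | tmul q r =>
    refine ⟨q.den, q.den_ne_zero, q.num • r, ?_⟩
    change (1 : ℚ) ⊗ₜ[ℤ] (q.num • r) = _
    rw [← smul_tmul, smul_tmul']
    congr 1
    rw [nsmul_eq_mul, Rat.den_mul_eq_num, zsmul_eq_mul, mul_one]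
  | add x y hx hy =>
    obtain ⟨m, hm, hx⟩ := hx
    obtain ⟨n, hn, hy⟩ := hy
    refine ⟨m * n, mul_ne_zero hm hn, ?_⟩
    rw [smul_add]
    refine Subring.add_mem _ ?_ ?_
    · rw [mul_comm, mul_smul]; exact nsmul_mem hx n
    · rw [mul_smul]; exact nsmul_mem hy m

theorem exists_alephOneFree_endEqScalars (R : Type u) [Ring R] [Nontrivial R] [Module.Free ℤ R]
    (κ : Cardinal.{u}) (hR : #R < κ) (hκ : κ ≤ 2 ^ ℵ₀) :
    ∃ (G : Type u) (_ : AddCommGroup G) (_ : Module R G),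
      AlephOneFree G ∧ #G = κ ∧ EndEqScalars R G := by
  classical
  let K := ℚ ⊗[ℤ] R
  let ι : R →+* K := (Algebra.TensorProduct.includeRight : R →ₐ[ℤ] ℚ ⊗[ℤ] R).toRingHom
  have hι : Function.Injective ι :=
    Algebra.TensorProduct.includeRight_injective (Int.cast_injective (α := ℚ))
  let S : Subring K := ι.range
  let f : R ≃+* S := RingEquiv.ofBijective ι.rangeRestrict
    ⟨fun x y h => hι (congrArg Subtype.val h), ι.rangeRestrict_surjective⟩
  have hfrac : ∀ a : K, ∃ n : ℕ, n ≠ 0 ∧ n • a ∈ S := exists_nsmul_mem_range_includeRight R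
  have hS : Module.Free ℤ S := Module.Free.of_equiv f.toAddEquiv.toIntLinearEquiv
  have hRinf : Infinite R := Module.Free.infinite ℤ R
  have hKinf : Infinite K := Infinite.of_injective ι hι
  have hR0 : ℵ₀ ≤ #R := aleph0_le_mk R
  have hK : #K ≤ #R := by
    have hsurj : Function.Surjective fun p : R × ULift.{u} ℕ => ((p.2.down : ℚ)⁻¹ • ι p.1 : K) := by
      intro a
      obtain ⟨n, hn, r, hr⟩ := hfrac a
      refine ⟨(r, ⟨n⟩), ?_⟩
      change (n : ℚ)⁻¹ • ι r = a
      rw [hr, ← Nat.cast_smul_eq_nsmul ℚ, inv_smul_smul₀ (Nat.cast_ne_zero.2 hn)]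
    refine (mk_le_of_surjective hsurj).trans ?_
    rw [mk_prod, lift_id, lift_id]
    exact mul_le_of_le hR0 le_rfl (by simp)
  have hκ0 : ℵ₀ ≤ κ := hR0.trans hR.le
  let A := (List Bool × List Bool × R) × κ.out
  have hA : #A = κ := by
    have h1 : #(List Bool × List Bool × R) ≤ #R := by
      simp only [mk_prod, lift_uzero]
      have hL : lift.{u} #(List Bool) ≤ #R := by simp
      exact mul_le_of_le hR0 hL (mul_le_of_le hR0 hL le_rfl)
    rw [mk_prod, lift_id, lift_id, mk_out]
    exact mul_eq_right hκ0 (h1.trans hR.le) (mk_ne_zero _)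
  obtain ⟨ν⟩ : Nonempty (A ↪ (ℕ → Bool)) := by
    rw [← lift_mk_le', hA]
    simpa using hκ
  let g : A → (List Bool →₀ K) := fun β => single β.1.1 1 + single β.1.2.1 (ι β.1.2.2)
  have hg : ∀ β s, g β s ∈ S := by
    intro β s
    refine S.add_mem ?_ ?_
    · rw [single_apply]; split_ifs
      exacts [S.one_mem, S.zero_mem]
    · rw [single_apply]; split_ifs
      exacts [⟨_, rfl⟩, S.zero_mem]
  have hcard : ∀ t s : List Bool, ∀ r : S, #K < #{β // g β = single t 1 + single s (r : K)} := by
    rintro t s ⟨_, r, rfl⟩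
    refine (hK.trans_lt hR).trans_le ?_
    rw [← mk_out κ]
    exact mk_le_of_injective (f := fun i => ⟨((t, s, r), i), rfl⟩) fun i j h => by
      simpa [A] using h
  let G := branchModule S ν g
  let _ : Module R G := Module.compHom G f.toRingHom
  refine ⟨G, inferInstance, inferInstance, alephOneFree_branchModule ν.injective hg,
    le_antisymm ?_ ?_, ?_, ?_⟩
  · refine (mk_subtype_le _).trans ?_
    have hA' : Infinite A := by rw [infinite_iff, hA]; exact hκ0
    rw [mk_prod, lift_id, lift_id, mk_finsupp_lift_of_infinite, mk_finsupp_of_infinite, hA]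
    have hKκ : #K ≤ κ := hK.trans hR.le
    exact mul_le_of_le hκ0 (max_le (by simp [hκ0]) (by simpa using hKκ)) (max_le le_rfl hKκ)
  · rw [← hA]
    refine mk_le_of_injective (f := fun β => (⟨_, branchVec_mem S ν g β 0⟩ : G)) fun β γ h => ?_
    have := congrArg (fun v => v.1.2) h
    simpa [branchVec_zero, single_left_inj] using this
  · intro r r' h
    have h := DFunLike.congr_fun h (⟨_, nodeVec_mem S ν g []⟩ : G)
    have h : ι r * (single [] 1 : List Bool →₀ K) [] = ι r' * (single [] 1 : List Bool →₀ K) [] :=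
      congrArg (fun v => v.1.1 []) h
    rw [single_eq_same, mul_one, mul_one] at h
    exact hι h
  · intro φ
    obtain ⟨a, ha⟩ := exists_forall_map_eq_smul hfrac ν.injective hg hcard φ
    obtain ⟨r, rfl⟩ := f.surjective a
    exact ⟨r, AddMonoidHom.ext fun v => (ha v).symm⟩

end Realization

section Summands

theorem AlephOneFree.of_injective {G H : Type*} [AddCommGroup G] [AddCommGroup H]
    (hG : AlephOneFree G) (f : H →+ G) (hf : Function.Injective f) : AlephOneFree H := by
  intro N hN
  have hc : Countable (N.map f) := by
    have := (Set.countable_coe_iff.1 hN).image f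
    exact Set.countable_coe_iff.2 this
  have := hG _ hc
  exact Module.Free.of_equiv (N.equivMapOfInjective f hf).symm.toIntLinearEquiv

theorem AddSubgroup.isCompl_range_ker {G : Type*} [AddCommGroup G] (p : G →+ G)
    (hp : ∀ x, p (p x) = p x) : IsCompl p.range p.ker := by
  rw [isCompl_iff, disjoint_iff_inf_le, codisjoint_iff_le_sup]
  constructor
  · rintro _ ⟨⟨x, rfl⟩, hx⟩
    have hx : p (p x) = 0 := hx
    rw [hp] at hx
    exact hx
  · intro x _
    refine AddSubgroup.mem_sup.2 ⟨p x, ⟨x, rfl⟩, x - p x, ?_, by abel⟩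
    change p (x - p x) = 0
    rw [map_sub, hp, sub_self]

theorem isDecomposable_of_idempotent {G : Type*} [AddCommGroup G] (p : G →+ G)
    (hp : ∀ x, p (p x) = p x) (h0 : ∃ x, p x ≠ 0) (h1 : ∃ x, p x ≠ x) : IsDecomposable G := by
  refine ⟨p.range, p.ker, fun h => ?_, fun h => ?_, AddSubgroup.isCompl_range_ker p hp⟩
  · obtain ⟨x, hx⟩ := h0
    have : p x ∈ p.range := ⟨x, rfl⟩
    rw [h] at this
    exact hx this
  · obtain ⟨x, hx⟩ := h1
    have : x - p x ∈ p.ker := by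
      change p (x - p x) = 0
      rw [map_sub, hp, sub_self]
    rw [h] at this
    exact hx (sub_eq_zero.1 this).symm

section EndEqScalars

variable {R G : Type*} [Ring R] [AddCommGroup G] [Module R G]

theorem EndEqScalars.exists_smul_eq (h : EndEqScalars R G) (φ : G →+ G) : ∃ r : R, ∀ x, φ x = r • x := by
  obtain ⟨r, hr⟩ := h.2 φ
  exact ⟨r, fun x => (DFunLike.congr_fun hr x).symm⟩

theorem EndEqScalars.eq_of_smul_eq (h : EndEqScalars R G) {r s : R}
    (hrs : ∀ x : G, r • x = s • x) : r = s :=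
  h.1 (AddMonoidHom.ext hrs)

theorem EndEqScalars.exists_smul_ne_zero (h : EndEqScalars R G) {r : R} (hr : r ≠ 0) :
    ∃ x : G, r • x ≠ 0 := by
  by_contra! hx
  exact hr (h.eq_of_smul_eq fun x => by rw [hx, zero_smul])

theorem EndEqScalars.exists_idempotent (h : EndEqScalars R G) {A B : AddSubgroup G}
    (hAB : IsCompl A B) : ∃ e : R, e * e = e ∧ (∀ x : G, e • x ∈ A) ∧ (∀ x ∈ A, e • x = x) ∧
      ∀ x ∈ B, e • x = 0 := by
  have hAB' := AddSubgroup.toIntSubmodule.isCompl hAB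
  obtain ⟨e, he⟩ := h.exists_smul_eq
    (Submodule.projection _ _ hAB').toAddMonoidHom
  have he' : ∀ x, e • x = Submodule.projection _ _ hAB' x := fun x => (he x).symm
  have hA : ∀ x ∈ A, e • x = x := fun x hx =>
    (he' x).trans (Submodule.projection_apply_of_mem_left hAB' hx)
  have hmem : ∀ x, e • x ∈ A := fun x => by
    rw [he']; exact Submodule.projection_apply_mem hAB' x
  refine ⟨e, h.eq_of_smul_eq fun x => ?_, hmem, hA, fun x hx => ?_⟩
  · rw [mul_smul, hA _ (hmem x)]
  · rw [he']; exact (Submodule.projection_apply_eq_zero_iff hAB').2 hx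

theorem EndEqScalars.isIndecomposable [Nontrivial R] (h : EndEqScalars R G)
    (hR : ∀ e : R, e * e = e → e = 0 ∨ e = 1) : IsIndecomposable G := by
  constructor
  · obtain ⟨x, hx⟩ := h.exists_smul_ne_zero (one_ne_zero : (1 : R) ≠ 0)
    exact ⟨⟨_, _, hx⟩⟩
  · rintro ⟨A, B, hA, hB, hAB⟩
    obtain ⟨e, he, hmem, heA, heB⟩ := h.exists_idempotent hAB
    rcases hR e he with rfl | rfl
    · exact hA ((AddSubgroup.eq_bot_iff_forall _).2 fun x hx => by rw [← heA x hx, zero_smul])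
    · exact hB ((AddSubgroup.eq_bot_iff_forall _).2 fun x hx => by rw [← heB x hx, one_smul])

theorem EndEqScalars.isSuperdecomposable (h : EndEqScalars R G)
    (hR : ∀ e : R, e * e = e → e ≠ 0 → ∃ f : R, f * f = f ∧ e * f = f ∧ f * e = f ∧ f ≠ 0 ∧ f ≠ e) :
    IsSuperdecomposable G := by
  rintro A ⟨B, hAB⟩ hA
  obtain ⟨e, he, hmem, heA, -⟩ := h.exists_idempotent hAB
  have he0 : e ≠ 0 := by
    rintro rfl
    exact hA ((AddSubgroup.eq_bot_iff_forall _).2 fun x hx => by rw [← heA x hx, zero_smul])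
  obtain ⟨f, hf, hef, hfe, hf0, hfe'⟩ := hR e he he0
  have hfA : ∀ x, f • x ∈ A := fun x => by
    rw [← hef, mul_smul]; exact hmem _
  let p : A →+ A := ((DistribSMul.toAddMonoidHom G f).comp A.subtype).codRestrict A fun x => hfA x
  have hp : ∀ x : A, (p x : G) = f • (x : G) := fun _ => rfl
  refine isDecomposable_of_idempotent p (fun x => Subtype.ext ?_) ?_ ?_
  · rw [hp, hp, smul_smul, hf]
  · obtain ⟨x, hx⟩ := h.exists_smul_ne_zero hf0
    refine ⟨⟨e • x, hmem x⟩, fun h0 => hx ?_⟩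
    have := congrArg Subtype.val h0
    rwa [hp, smul_smul, hfe] at this
  · obtain ⟨x, hx⟩ := h.exists_smul_ne_zero (sub_ne_zero.2 hfe')
    refine ⟨⟨e • x, hmem x⟩, fun h0 => hx ?_⟩
    have := congrArg Subtype.val h0
    rw [hp, smul_smul, hfe] at this
    rw [sub_smul, this, sub_self]

/-- The subgroup `e G` of an `R`-module `G`. -/
def smulRange (G : Type*) [AddCommGroup G] [Module R G] (e : R) : AddSubgroup G :=
  (DistribSMul.toAddMonoidHom G e).range

theorem isIsoToSummand_smulRange {e : R} (he : e * e = e) : IsIsoToSummand (smulRange G e) G :=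
  ⟨smulRange G e, ⟨_, AddSubgroup.isCompl_range_ker _ fun x => by
    change e • e • x = e • x
    rw [smul_smul, he]⟩, ⟨AddEquiv.refl _⟩⟩

theorem isIsoToSummand_of_mul_eq_one {e u v : R} (hvu : v * u = 1) (heu : e * u = u)
    : IsIsoToSummand G (smulRange G e) := by
  have huv : ∀ x : G, (u * v) • x ∈ smulRange G e := fun x => by
    rw [← heu, mul_assoc, mul_smul]; exact ⟨_, rfl⟩
  let p : smulRange G e →+ smulRange G e :=
    ((DistribSMul.toAddMonoidHom G (u * v)).comp (smulRange G e).subtype).codRestrict _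
      fun x => huv x
  have hp : ∀ x : smulRange G e, (p x : G) = (u * v) • (x : G) := fun _ => rfl
  have hu : ∀ x : G, u • x ∈ smulRange G e := fun x => by
    rw [← heu, mul_smul]; exact ⟨_, rfl⟩
  let f : G →+ smulRange G e := (DistribSMul.toAddMonoidHom G u).codRestrict _ hu
  have hf : ∀ x : G, (f x : G) = u • x := fun _ => rfl
  have hrange : ∀ x, f x ∈ p.range := fun x => ⟨f x, Subtype.ext (by
    rw [hp, hf, smul_smul, mul_assoc, hvu, mul_one])⟩
  refine ⟨p.range, ⟨p.ker, AddSubgroup.isCompl_range_ker p fun x => Subtype.ext ?_⟩,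
    ⟨AddEquiv.ofBijective (f.codRestrict p.range hrange) ⟨fun x y h => ?_, ?_⟩⟩⟩
  · rw [hp, hp, smul_smul, mul_assoc, ← mul_assoc v, hvu, one_mul]
  · have h : u • x = u • y := congrArg (fun z => z.1.1) h
    rw [← one_smul R x, ← one_smul R y, ← hvu, mul_smul, mul_smul, h]
  · rintro ⟨_, ⟨y, rfl⟩⟩
    refine ⟨v • (y : G), Subtype.ext (Subtype.ext ?_)⟩
    change u • v • (y : G) = (u * v) • (y : G)
    rw [mul_smul]

theorem EndEqScalars.exists_mul_eq_of_equiv (h : EndEqScalars R G) {e : R} (he : e * e = e)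
    (θ : G ≃+ smulRange G e) : ∃ a b : R, b * a = 1 ∧ a * b = e := by
  obtain ⟨a, ha⟩ := h.exists_smul_eq ((smulRange G e).subtype.comp θ.toAddMonoidHom)
  obtain ⟨b, hb⟩ := h.exists_smul_eq (θ.symm.toAddMonoidHom.comp
    (DistribSMul.toAddMonoidHom G e).rangeRestrict)
  have ha' : ∀ x, a • x = (θ x : G) := fun x => (ha x).symm
  have hb' : ∀ x, b • x = θ.symm ⟨e • x, x, rfl⟩ := fun x => (hb x).symm
  refine ⟨a, b, h.eq_of_smul_eq fun x => ?_, h.eq_of_smul_eq fun x => ?_⟩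
  · rw [mul_smul, one_smul, ha', hb', AddEquiv.symm_apply_eq]
    refine Subtype.ext ?_
    obtain ⟨y, hy⟩ := (θ x).2
    change e • (θ x : G) = (θ x : G)
    rw [← hy]
    change e • e • y = e • y
    rw [smul_smul, he]
  · rw [mul_smul, hb', ha', AddEquiv.apply_symm_apply]

end EndEqScalars

end Summands

section TestRings

/-- The finite sets of natural numbers, as a monoid under union. -/
structure FinsetUnion where
  /-- The underlying finite set. -/
  toFinset : Finset ℕ

namespace FinsetUnion

theorem toFinset_injective : Function.Injective toFinset := by
  rintro ⟨s⟩ ⟨t⟩ rfl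
  rfl

instance : Mul FinsetUnion := ⟨fun s t => ⟨s.toFinset ∪ t.toFinset⟩⟩

instance : One FinsetUnion := ⟨⟨∅⟩⟩

@[simp] theorem toFinset_mul (s t : FinsetUnion) : (s * t).toFinset = s.toFinset ∪ t.toFinset := rfl

instance : CommMonoid FinsetUnion where
  mul_assoc s t u := toFinset_injective (Finset.union_assoc _ _ _)
  one_mul s := toFinset_injective (Finset.empty_union _)
  mul_one s := toFinset_injective (Finset.union_empty _)
  mul_comm s t := toFinset_injective (Finset.union_comm _ _)

instance : Countable FinsetUnion := toFinset_injective.countable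

end FinsetUnion

/-- The elements `u ^ i * f ^ ε * v ^ j` of the monoid with generators `u, f, v` and relations
`v * u = 1`, `f * f = f`, `f * u = u`, `v * f = v`. -/
@[ext]
structure ShiftMonoid where
  /-- The exponent of `u`. -/
  i : ℕ
  /-- Whether `f` occurs. -/
  b : Bool
  /-- The exponent of `v`. -/
  j : ℕ

namespace ShiftMonoid

instance : Mul ShiftMonoid := ⟨fun x y => ⟨x.i + (y.i - x.j),
  if x.j < y.i then y.b else if y.i < x.j then x.b else x.b || y.b, y.j + (x.j - y.i)⟩⟩

instance : One ShiftMonoid := ⟨⟨0, false, 0⟩⟩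

theorem mul_def (x y : ShiftMonoid) : x * y = ⟨x.i + (y.i - x.j),
  if x.j < y.i then y.b else if y.i < x.j then x.b else x.b || y.b, y.j + (x.j - y.i)⟩ := rfl

theorem one_def : (1 : ShiftMonoid) = ⟨0, false, 0⟩ := rfl

instance : Monoid ShiftMonoid where
  mul_assoc x y z := by
    simp only [mul_def, ShiftMonoid.mk.injEq]
    refine ⟨by omega, ?_, by omega⟩
    rcases lt_trichotomy x.j y.i with h1 | h1 | h1 <;>
      rcases lt_trichotomy y.j z.i with h2 | h2 | h2 <;> grind
  one_mul x := by
    simp only [mul_def, one_def]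
    ext <;> simp
  mul_one x := by
    simp only [mul_def, one_def]
    ext <;> simp

instance : Countable ShiftMonoid :=
  Function.Injective.countable (f := fun x : ShiftMonoid => (x.i, x.b, x.j)) fun x y h => by
    simp only [Prod.mk.injEq] at h
    exact ShiftMonoid.ext h.1 h.2.1 h.2.2

/-- The weight of an element, which extends to a trace on the monoid algebra. -/
def weight (x : ShiftMonoid) : ℤ := if x.b = true ∧ x.i = x.j then 1 else 0

theorem weight_mul_comm (x y : ShiftMonoid) : weight (x * y) = weight (y * x) := by
  simp only [weight, mul_def]
  refine if_congr ?_ rfl rfl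
  grind

end ShiftMonoid

instance MonoidAlgebra.free_int (M : Type*) : Module.Free ℤ (MonoidAlgebra ℤ M) :=
  Module.Free.of_equiv (MonoidAlgebra.coeffAddEquiv (R := ℤ) (M := M)).symm.toIntLinearEquiv

instance MonoidAlgebra.countable_int (M : Type*) [Countable M] : Countable (MonoidAlgebra ℤ M) :=
  MonoidAlgebra.coeffEquiv.injective.countable

theorem exists_smaller_idempotent (e : MonoidAlgebra ℤ FinsetUnion) (he : e * e = e) (h0 : e ≠ 0) :
    ∃ f, f * f = f ∧ e * f = f ∧ f * e = f ∧ f ≠ 0 ∧ f ≠ e := by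
  classical
  obtain ⟨s, hs⟩ : ∃ s, e.coeff s ≠ 0 := by
    by_contra! h
    exact h0 (MonoidAlgebra.ext (Finsupp.ext h))
  obtain ⟨n, hn⟩ : ∃ n, ∀ t ∈ e.coeff.support, n ∉ t.toFinset := by
    obtain ⟨n, hn⟩ := (e.coeff.support.biUnion FinsetUnion.toFinset).exists_notMem
    exact ⟨n, fun t ht h => hn (Finset.mem_biUnion.2 ⟨t, ht, h⟩)⟩
  set x : MonoidAlgebra ℤ FinsetUnion := MonoidAlgebra.single ⟨{n}⟩ 1 with hx
  have hxx : x * x = x := by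
    rw [hx, MonoidAlgebra.single_mul_single, one_mul]
    congr 1
    exact FinsetUnion.toFinset_injective (Finset.union_self _)
  refine ⟨e * x, ?_, ?_, ?_, ?_, ?_⟩
  · rw [mul_mul_mul_comm, he, hxx]
  · rw [← mul_assoc, he]
  · rw [mul_right_comm, he]
  · intro h
    have h1 : (e * x).coeff (s * ⟨{n}⟩) = e.coeff s * 1 :=
      MonoidAlgebra.coeff_mul_single_eq_coeff_mul s fun t ht => by
        constructor
        · intro h
          have h' := congrArg FinsetUnion.toFinset h
          simp only [FinsetUnion.toFinset_mul] at h'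
          have ht' := hn t ht
          have hs' := hn s (Finsupp.mem_support_iff.2 hs)
          refine FinsetUnion.toFinset_injective (Finset.ext fun a => ?_)
          have := Finset.ext_iff.1 h' a
          by_cases ha : a = n
          · subst ha; simp [ht', hs']
          · simpa [ha] using this
        · rintro rfl; rfl
    rw [h] at h1
    exact hs (by simpa using h1.symm)
  · intro h
    have h1 : (e * x).coeff s = 0 := MonoidAlgebra.coeff_mul_single_of_forall_mul_ne _ _ fun d hd =>
      hn s (Finsupp.mem_support_iff.2 hs) (by rw [← hd]; simp)
    rw [h] at h1
    exact hs h1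

theorem exists_trace_separating : ∃ e u v : MonoidAlgebra ℤ ShiftMonoid, e * e = e ∧ v * u = 1 ∧
    e * u = u ∧ ∀ a b : MonoidAlgebra ℤ ShiftMonoid, b * a = 1 → a * b ≠ e := by
  let τ : MonoidAlgebra ℤ ShiftMonoid →+ ℤ :=
    (Finsupp.linearCombination ℤ ShiftMonoid.weight).toAddMonoidHom.comp
      (MonoidAlgebra.coeffAddEquiv (R := ℤ) (M := ShiftMonoid)).toAddMonoidHom
  have hτ : ∀ m r, τ (MonoidAlgebra.single m r) = r * m.weight := fun m r => by
    simp [τ]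
  have hcomm : ∀ x y, τ (x * y) = τ (y * x) := by
    intro x y
    induction x using MonoidAlgebra.induction_linear with
    | zero => simp
    | add x x' h h' => simp [add_mul, mul_add, h, h']
    | single m r =>
      induction y using MonoidAlgebra.induction_linear with
      | zero => simp
      | add x x' h h' => simp [add_mul, mul_add, h, h']
      | single n s =>
        rw [MonoidAlgebra.single_mul_single, MonoidAlgebra.single_mul_single, hτ, hτ,
          ShiftMonoid.weight_mul_comm, mul_comm r]
  refine ⟨.single ⟨0, true, 0⟩ 1, .single ⟨1, false, 0⟩ 1, .single ⟨0, false, 1⟩ 1, ?_, ?_, ?_, ?_⟩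
  · rw [MonoidAlgebra.single_mul_single]; rfl
  · rw [MonoidAlgebra.single_mul_single]; rfl
  · rw [MonoidAlgebra.single_mul_single]; rfl
  · intro a b hba hab
    have h1 : τ (b * a) = 0 := by
      rw [hba, MonoidAlgebra.one_def, hτ]; rfl
    rw [hcomm, hab, hτ] at h1
    exact absurd h1 (by decide)

end TestRings

section TestProblems

open Cardinal

theorem AlephOneFree.smul_injective {G : Type*} [AddCommGroup G] (hG : AlephOneFree G) {n : ℤ}
    (hn : n ≠ 0) : Function.Injective fun x : G => n • x := by
  have h0 : ∀ x : G, n • x = 0 → x = 0 := by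
    intro x hx
    have : Countable (AddSubgroup.zmultiples x) :=
      (zmultiplesHom G x).rangeRestrict_surjective.countable
    have := hG (AddSubgroup.zmultiples x) this
    have hx' : n • (⟨x, AddSubgroup.mem_zmultiples x⟩ : AddSubgroup.zmultiples x) = 0 :=
      Subtype.ext hx
    exact congrArg Subtype.val ((smul_eq_zero.1 hx').resolve_left hn)
  intro x y h
  refine sub_eq_zero.1 (h0 _ ?_)
  rw [smul_sub]
  exact sub_eq_zero.2 h

theorem exists_alephOneFree_endEqScalars_aleph_one (R : Type) [Ring R] [Nontrivial R] [Countable R]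
    [Module.Free ℤ R] : ∃ (G : Type) (_ : AddCommGroup G) (_ : Module R G),
      AlephOneFree G ∧ #G = ℵ_ 1 ∧ EndEqScalars R G :=
  exists_alephOneFree_endEqScalars R (ℵ_ 1) ((mk_le_aleph0 (α := R)).trans_lt aleph0_lt_aleph_one)
    aleph_one_le_continuum

theorem exists_rigid_indecomposable : ∃ (G : Type) (_ : AddCommGroup G),
    AlephOneFree G ∧ #G = ℵ_ 1 ∧ IsRigid G ∧ IsIndecomposable G := by
  obtain ⟨G, hG, hM, hfree, hcard, hend⟩ := exists_alephOneFree_endEqScalars_aleph_one ℤ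
  have hrigid : IsRigid G := by
    have : hM = AddCommGroup.toIntModule G := Subsingleton.elim _ _
    rw [IsRigid, ← this]
    exact hend
  exact ⟨G, hG, hfree, hcard, hrigid, hend.isIndecomposable fun e he => by
    have : e * (e - 1) = 0 := by rw [mul_sub, he, mul_one, sub_self]
    exact (mul_eq_zero.1 this).imp id sub_eq_zero.1⟩

theorem exists_superdecomposable : ∃ (G : Type) (_ : AddCommGroup G),
    AlephOneFree G ∧ #G = ℵ_ 1 ∧ IsSuperdecomposable G := by
  obtain ⟨G, hG, hM, hfree, hcard, hend⟩ :=
    exists_alephOneFree_endEqScalars_aleph_one (MonoidAlgebra ℤ FinsetUnion)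
  exact ⟨G, hG, hfree, hcard, hend.isSuperdecomposable exists_smaller_idempotent⟩

theorem exists_mutual_summands : ∃ (A B : Type) (_ : AddCommGroup A) (_ : AddCommGroup B),
    AlephOneFree A ∧ #A = ℵ_ 1 ∧ AlephOneFree B ∧ #B = ℵ_ 1 ∧
      IsIsoToSummand A B ∧ IsIsoToSummand B A ∧ IsEmpty (A ≃+ B) := by
  obtain ⟨G, hG, hM, hfree, hcard, hend⟩ :=
    exists_alephOneFree_endEqScalars_aleph_one (MonoidAlgebra ℤ ShiftMonoid)
  obtain ⟨e, u, v, he, hvu, heu, hsep⟩ := exists_trace_separating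
  refine ⟨G, smulRange G e, hG, inferInstance, hfree, hcard,
    hfree.of_injective (smulRange G e).subtype Subtype.val_injective, ?_,
    isIsoToSummand_of_mul_eq_one hvu heu, isIsoToSummand_smulRange he, ⟨fun θ => ?_⟩⟩
  · refine le_antisymm ((mk_subtype_le _).trans hcard.le) ?_
    rw [← hcard]
    refine mk_le_of_injective (f := fun x : G => (⟨u • x, u • x, ?_⟩ : smulRange G e))
      fun x y h => ?_
    · change e • u • x = u • x
      rw [smul_smul, heu]
    · have h : u • x = u • y := congrArg Subtype.val h
      rw [← one_smul (MonoidAlgebra ℤ ShiftMonoid) x,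
        ← one_smul (MonoidAlgebra ℤ ShiftMonoid) y, ← hvu, mul_smul, mul_smul, h]
  · obtain ⟨a, b, hba, hab⟩ := hend.exists_mul_eq_of_equiv he θ
    exact hsep a b hba hab

theorem Zsqrtd.free_countable (d : ℤ) : Module.Free ℤ (ℤ√d) ∧ Countable (ℤ√d) := by
  let e : ℤ√d ≃+ ℤ × ℤ :=
    { toFun := fun z => (z.re, z.im)
      invFun := fun p => ⟨p.1, p.2⟩
      left_inv := fun _ => rfl
      right_inv := fun _ => rfl
      map_add' := fun _ _ => rfl }
  exact ⟨Module.Free.of_equiv e.symm.toIntLinearEquiv, e.injective.countable⟩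

theorem Zsqrtd.mul_star_eq_one_of_mul_eq {r s t : ℤ√(-5)} (hs : r * s = 2) (ht : r * t = ⟨1, 1⟩) :
    r * star r = 1 := by
  have hs' := congrArg Zsqrtd.norm hs
  have ht' := congrArg Zsqrtd.norm ht
  rw [Zsqrtd.norm_mul] at hs' ht'
  have h2 : Zsqrtd.norm (2 : ℤ√(-5)) = 4 := by decide
  have h6 : Zsqrtd.norm (⟨1, 1⟩ : ℤ√(-5)) = 6 := by decide
  rw [h2] at hs'
  rw [h6] at ht'
  have hdvd : r.norm ∣ 2 := by
    have h : r.norm ∣ 6 - 4 := dvd_sub (Dvd.intro _ ht') (Dvd.intro _ hs')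
    simpa using h
  have hnn : 0 ≤ r.norm := Zsqrtd.norm_nonneg (by norm_num) r
  have hle := Int.le_of_dvd (by norm_num) hdvd
  have hdef : r.norm = r.re * r.re + 5 * (r.im * r.im) := by rw [Zsqrtd.norm_def]; ring
  have h1 : r.norm = 1 := by
    interval_cases h : r.norm
    · simp at hdvd
    · rfl
    · exfalso
      have him : r.im = 0 := by nlinarith [mul_self_nonneg r.re, mul_self_nonneg r.im]
      rw [him] at hdef
      have h1 : r.re < 2 := by nlinarith
      have h2 : -2 < r.re := by nlinarith
      interval_cases h : r.re <;> omega
  rw [← Zsqrtd.norm_eq_mul_conj, h1]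
  rfl

theorem exists_isomorphic_squares : ∃ (A B : Type) (_ : AddCommGroup A) (_ : AddCommGroup B),
    AlephOneFree A ∧ #A = ℵ_ 1 ∧ AlephOneFree B ∧ #B = ℵ_ 1 ∧
      Nonempty ((A × A) ≃+ (B × B)) ∧ IsEmpty (A ≃+ B) := by
  have := (Zsqrtd.free_countable (-5)).1
  have := (Zsqrtd.free_countable (-5)).2
  obtain ⟨G, hG, hM, hfree, hcard, hend⟩ := exists_alephOneFree_endEqScalars_aleph_one (ℤ√(-5))
  let w : ℤ√(-5) := ⟨1, 1⟩
  let w' : ℤ√(-5) := ⟨1, -1⟩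
  let c : ℤ√(-5) := ⟨-2, 1⟩
  have hww' : w * w' = 6 := by decide
  have hww : w * w = 2 * c := by decide
  have hw'c : w' * c = 3 * w := by decide
  have hw' : w' = 2 - w := by decide
  let sm : ℤ√(-5) → G →+ G := DistribSMul.toAddMonoidHom G
  have htwo : Function.Injective fun x : G => (2 : ℤ√(-5)) • x := by
    have := hfree.smul_injective (n := 2) two_ne_zero
    simpa [two_smul] using this
  let B : AddSubgroup G := ((sm 2).coprod (sm w)).range
  have hBmem : ∀ x, x ∈ B ↔ ∃ p q : G, (2 : ℤ√(-5)) • p + w • q = x := fun x =>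
    ⟨fun ⟨p, h⟩ => ⟨p.1, p.2, h⟩, fun ⟨p, q, h⟩ => ⟨(p, q), h⟩⟩
  have hB2 : ∀ x : G, (2 : ℤ√(-5)) • x ∈ B := fun x => (hBmem _).2 ⟨x, 0, by simp⟩
  have hBw : ∀ x : G, w • x ∈ B := fun x => (hBmem _).2 ⟨0, x, by simp⟩
  refine ⟨G, B, hG, inferInstance, hfree, hcard,
    hfree.of_injective B.subtype Subtype.val_injective, ?_, ?_, ⟨fun θ => ?_⟩⟩
  · refine le_antisymm ((mk_subtype_le _).trans hcard.le) ?_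
    rw [← hcard]
    exact mk_le_of_injective (f := fun x : G => (⟨_, hB2 x⟩ : B))
      fun x y h => htwo (congrArg Subtype.val h)
  · have hBw' : ∀ x y : G, w' • x + (2 : ℤ√(-5)) • y ∈ B := fun x y =>
      (hBmem _).2 ⟨x + y, -x, by rw [hw']; module⟩
    have hBr : ∀ x : G × G, ((sm 2).coprod (sm w)) x ∈ B := fun x => ⟨x, rfl⟩
    let f : G × G →+ B × B :=
      ((((sm 2).coprod (sm w)).codRestrict B hBr).prod
        (((sm w').coprod (sm 2)).codRestrict B fun x => hBw' x.1 x.2))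
    have hf1 : ∀ x : G × G, ((f x).1 : G) = (2 : ℤ√(-5)) • x.1 + w • x.2 := fun _ => rfl
    have hf2 : ∀ x : G × G, ((f x).2 : G) = w' • x.1 + (2 : ℤ√(-5)) • x.2 := fun _ => rfl
    refine ⟨AddEquiv.ofBijective f ⟨(injective_iff_map_eq_zero f).2 ?_, ?_⟩⟩
    · rintro ⟨x, y⟩ h
      have h1 : (2 : ℤ√(-5)) • x + w • y = 0 := congrArg (fun z => (z.1 : G)) h
      have h2 : w' • x + (2 : ℤ√(-5)) • y = 0 := congrArg (fun z => (z.2 : G)) h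
      have hx : (2 : ℤ√(-5)) • x = 0 := by
        have h3 : (2 : ℤ√(-5)) • x = w • (w' • x + (2 : ℤ√(-5)) • y) -
            (2 : ℤ√(-5)) • ((2 : ℤ√(-5)) • x + w • y) := by
          match_scalars <;> decide
        rw [h3, h1, h2, smul_zero, smul_zero, sub_zero]
      have hx0 : x = 0 := htwo (hx.trans (smul_zero _).symm)
      rw [hx0, smul_zero, zero_add] at h2
      rw [hx0, htwo (h2.trans (smul_zero _).symm)]
      rfl
    · rintro ⟨⟨b₁, hb₁⟩, ⟨b₂, hb₂⟩⟩
      obtain ⟨p, q, rfl⟩ := (hBmem _).1 hb₁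
      obtain ⟨p', q', rfl⟩ := (hBmem _).1 hb₂
      refine ⟨(w • p' + c • q' - ((2 : ℤ√(-5)) • p + w • q),
        w' • p + (3 : ℤ√(-5)) • q - ((2 : ℤ√(-5)) • p' + w • q')), ?_⟩
      refine Prod.ext (Subtype.ext ?_) (Subtype.ext ?_)
      · rw [hf1]
        match_scalars <;> decide
      · rw [hf2]
        match_scalars <;> decide
  · obtain ⟨r, hr⟩ := hend.exists_smul_eq (B.subtype.comp θ.toAddMonoidHom)
    have hr' : ∀ x, r • x = (θ x : G) := fun x => (hr x).symm
    have hdiv : ∀ a : ℤ√(-5), (∀ x : G, a • x ∈ B) → ∃ s, r * s = a := by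
      intro a ha
      obtain ⟨s, hs⟩ := hend.exists_smul_eq
        (θ.symm.toAddMonoidHom.comp ((sm a).codRestrict B ha))
      refine ⟨s, hend.eq_of_smul_eq fun x => ?_⟩
      rw [mul_smul, ← hs, hr']
      exact congrArg Subtype.val (θ.apply_symm_apply _)
    obtain ⟨s, hs⟩ := hdiv 2 hB2
    obtain ⟨t, ht⟩ := hdiv w hBw
    have hunit := Zsqrtd.mul_star_eq_one_of_mul_eq hs ht
    have hall : ∀ x : G, x ∈ B := fun x => by
      rw [← one_smul (ℤ√(-5)) x, ← hunit, mul_smul, hr']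
      exact (θ _).2
    have hsurj : Function.Surjective (sm 2) := by
      intro x
      obtain ⟨p, q, rfl⟩ := (hBmem _).1 (hall x)
      obtain ⟨p', q', rfl⟩ := (hBmem _).1 (hall q)
      refine ⟨p + w • p' + c • q', ?_⟩
      change (2 : ℤ√(-5)) • (p + w • p' + c • q') = _
      match_scalars <;> decide
    obtain ⟨a, ha⟩ := hend.exists_smul_eq
      (AddEquiv.ofBijective (sm 2) ⟨htwo, hsurj⟩).symm.toAddMonoidHom
    have h2a : (2 : ℤ√(-5)) * a = 1 := hend.eq_of_smul_eq fun x => by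
      rw [mul_smul, one_smul, ← ha]
      exact (AddEquiv.ofBijective (sm 2) ⟨htwo, hsurj⟩).apply_symm_apply x
    have := congrArg Zsqrtd.re h2a
    simp at this
    omega

end TestProblems

theorem theorem4p1 :
    -- the realization theorem
    (∀ (R : Type u) [Ring R] [Nontrivial R], Module.Free ℤ R →
      ∀ κ : Cardinal.{u}, Cardinal.mk R < κ → κ ≤ 2 ^ Cardinal.aleph0 →
        ∃ (G : Type u) (_ : AddCommGroup G) (_ : Module R G),
          AlephOneFree G ∧ Cardinal.mk G = κ ∧ EndEqScalars R G) ∧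
    -- the case of the ring of integers
    (∃ (G : Type) (_ : AddCommGroup G),
      AlephOneFree G ∧ Cardinal.mk G = Cardinal.aleph 1 ∧ IsRigid G ∧ IsIndecomposable G) ∧
    -- superdecomposable groups
    (∃ (G : Type) (_ : AddCommGroup G),
      AlephOneFree G ∧ Cardinal.mk G = Cardinal.aleph 1 ∧ IsSuperdecomposable G) ∧
    -- first test problem of Kaplansky
    (∃ (A B : Type) (_ : AddCommGroup A) (_ : AddCommGroup B),
      AlephOneFree A ∧ Cardinal.mk A = Cardinal.aleph 1 ∧
      AlephOneFree B ∧ Cardinal.mk B = Cardinal.aleph 1 ∧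
      IsIsoToSummand A B ∧ IsIsoToSummand B A ∧ IsEmpty (A ≃+ B)) ∧
    -- second test problem of Kaplansky
    (∃ (A B : Type) (_ : AddCommGroup A) (_ : AddCommGroup B),
      AlephOneFree A ∧ Cardinal.mk A = Cardinal.aleph 1 ∧
      AlephOneFree B ∧ Cardinal.mk B = Cardinal.aleph 1 ∧
      Nonempty ((A × A) ≃+ (B × B)) ∧ IsEmpty (A ≃+ B)) := by
  refine ⟨fun R _ _ hR κ hκ hκ' => exists_alephOneFree_endEqScalars R κ hκ hκ',
    exists_rigid_indecomposable, exists_superdecomposable, exists_mutual_summands,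
    exists_isomorphic_squares⟩
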